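/- Let $k$ be a finite field with $q$ elements, $A=k[T]$, and let $L\supseteq k$ be any field. A Drinfeld $A$-module of rank $2$ with $\gamma(T)=1$ over a field $\Omega\supseteq k$ is given by $\varphi_T=1+g\tau+\Delta\tau^2$ with $\Delta\ne0$, where $\tau(x)=x^q$; its invariant is $J(\varphi)=g^{q+1}/\Delta$. An isomorphism $\varphi\to\varphi'$ is a $c\in\Omega^*$ with $c\,\varphi_T=\varphi'_T\,c$. Let ${\rm X}_0(T^n)$ be the Drinfeld modular curve over $L$, covering the $J$-line, that parametrizes pairs $(\varphi,G)$ consisting of such a module and an $A$-submodule $G\cong A/T^nA$. With $\Omega$ a separable closure of $L(J)$, its rational functions are the $\Omega$-valued functions of the pairs $(\varphi,G)$ over $\Omega$ with $J(\varphi)=J$ that depend only on the isomorphism class of the pair and commute with ${\rm Gal}(\Omega/L(J))$. Every such pair $(\varphi,G)$ is isomorphic to a pair with $\Delta=-1$. For a pair with $\Delta=-1$ choose a generator $x_1$ of the $k$-space of $T$-torsion points in $G$, for $1\le j\le n$ choose $y_j\in G$ with $\varphi_{T^{j-1}}(y_j)=x_1$, and put $$x_j=(P_{x_{j-1}}\circ\cdots\circ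 P_{x_1})(y_j),\quad P_x(Y)=x^{q-1}Y-Y^q,\qquad z_j=x_{j-1}x_j,\quad Z_j=z_j^{q-1}\quad(2\le j\le n).$$ Let $n\ge2$. Then ${\rm X}_0(T^n)$ is irreducible, i.e. its ring of rational functions is a field. Such coordinates exist for every pair, and $x_1^{q^2-1}$ and $Z_2,\dots,Z_n$ do not depend on the choices and are rational functions on ${\rm X}_0(T^n)$. The function field of ${\rm X}_0(T^n)$ is generated over $L$ by $Z_2,\dots,Z_n$. No $1+Z_j$ vanishes at any of the pairs above, $$Z_2(1+Z_2)^{q-1}=x_1^{q^2-1},\qquad Z_{j+1}(1+Z_{j+1})^{q-1}=\frac{Z_j^q}{(1+Z_j)^{q-1}}\quad(2\le j\le n-1),$$ and these are the only relations: the ideal of all polynomials over $L$ in $n$ variables that vanish at $(x_1^{q^2-1},Z_2,\dots,Z_n)$ is generated by these relations with denominators cleared. For $2\le j\le n-1$ the field $L(Z_j,Z_{j+1})$ has degree $q$ over $L(Z_j)$ and over $L(Z_{j+1})$. The natural map ${\rm X}_0(T^n)\to{\rm X}_0(T^{n-1})$, $(\varphi,G)\mapsto(\varphi,TG)$, has degree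 $q$, and the pullbacks of the functions $x_1^{q^2-1}$ and $Z_j$ ($2\le j\le n-1$) on ${\rm X}_0(T^{n-1})$ are the functions of the same name on ${\rm X}_0(T^n)$. -/

import Mathlib

open Polynomial

noncomputable section

namespace DrinfeldTower

theorem exists_iso_map {k : Type*} [Field k] {M : Type*} [AddCommGroup M] [Module k[X] M] (G : Submodule k[X] M)
    {m n : ℕ} (h : m ≤ n) (e : G ≃ₗ[k[X]] k[X] ⧸ Ideal.span {(X : k[X]) ^ n}) :
    Nonempty (G.map (LinearMap.lsmul k[X] M (X ^ (n - m))) ≃ₗ[k[X]]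
      k[X] ⧸ Ideal.span {(X : k[X]) ^ m}) := by
  let f : G →ₗ[k[X]] G.map (LinearMap.lsmul k[X] M (X ^ (n - m))) :=
    (LinearMap.lsmul k[X] M (X ^ (n - m))).submoduleMap G
  have hf : Function.Surjective f := LinearMap.submoduleMap_surjective _ _
  let F : k[X] →ₗ[k[X]] G.map (LinearMap.lsmul k[X] M (X ^ (n - m))) :=
    f ∘ₗ e.symm.toLinearMap ∘ₗ (Ideal.span {(X : k[X]) ^ n}).mkQ
  have hF : Function.Surjective F :=
    hf.comp (e.symm.surjective.comp (Submodule.mkQ_surjective _))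
  have hker : LinearMap.ker F = Ideal.span {(X : k[X]) ^ m} := by
    ext a
    rw [LinearMap.mem_ker, Ideal.mem_span_singleton]
    have h1 : F a = 0 ↔ (X : k[X]) ^ (n - m) • e.symm (Submodule.Quotient.mk a) = 0 := by
      rw [← Subtype.coe_inj, ← Subtype.coe_inj]
      rfl
    rw [h1, ← map_smul, LinearEquiv.map_eq_zero_iff, ← Submodule.Quotient.mk_smul,
      Submodule.Quotient.mk_eq_zero, Ideal.mem_span_singleton, smul_eq_mul]
    obtain ⟨d, rfl⟩ := Nat.exists_eq_add_of_le h
    rw [Nat.add_sub_cancel_left, pow_add, mul_comm (X ^ m)]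
    exact mul_dvd_mul_iff_left (pow_ne_zero _ X_ne_zero)
  exact ⟨((LinearMap.quotKerEquivOfSurjective F hF).symm).trans
    (Submodule.quotEquivOfEq _ _ hker)⟩

theorem of_pow {k Ω : Type*} [Field k] [Field Ω] [Algebra k Ω] (f : Module.End k Ω) (r : ℕ) (y : Ω) :
    (X : k[X]) ^ r • Module.AEval'.of f y = Module.AEval'.of f ((f ^ r) y) := by
  rw [← Module.AEval.of_aeval_smul]
  simp

/-- The ring homomorphism `f` makes `B` a free `A`-module of rank `d`; for fields, `f` is a field
extension of degree `d`. -/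
def HasDegree {A B : Type*} [CommRing A] [CommRing B] (f : A →+* B) (d : ℕ) : Prop :=
  letI := f.toAlgebra
  Nonempty (Module.Basis (Fin d) A B)

section Modules

variable (k : Type*) [Field k] [Fintype k]
variable (Ω : Type*) [Field Ω] [Algebra k Ω]

/-- The `q`-power Frobenius `τ`, with `q = #k`, as a `k`-linear endomorphism of the field `Ω`. -/
def tau : Module.End k Ω := (FiniteField.frobeniusAlgHom k Ω).toLinearMap

/-- A Drinfeld `k[T]`-module of rank two over `Ω`. It is determined by
`φ_T = l₀ + g τ + Δ τ²`, where `Δ ≠ 0`; here `l₀ = γ(T)`. -/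
structure DrinfeldModule where
  l₀ : Ω
  g : Ω
  Δ : Ω
  Δ_ne_zero : Δ ≠ 0

variable {k Ω}

/-- The operator `φ_T = l₀ + g τ + Δ τ²` on `Ω`. -/
def DrinfeldModule.opT (k : Type*) [Field k] [Fintype k] [Algebra k Ω]
    (φ : DrinfeldModule Ω) : Module.End k Ω :=
  LinearMap.mulLeft k φ.l₀ + LinearMap.mulLeft k φ.g * tau k Ω
    + LinearMap.mulLeft k φ.Δ * tau k Ω ^ 2

/-- `Ω` with the `k[T]`-module structure given by `φ`, i.e. `a ∈ k[T]` acts as `φ_a = a(φ_T)`. -/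
abbrev DrinfeldModule.Points (k : Type*) [Field k] [Fintype k] [Algebra k Ω]
    (φ : DrinfeldModule Ω) : Type _ := Module.AEval' (φ.opT k)

/-- The invariant `J(φ) = g^(q+1) / Δ`. -/
def DrinfeldModule.J (k : Type*) [Fintype k] (φ : DrinfeldModule Ω) : Ω :=
  φ.g ^ (Fintype.card k + 1) / φ.Δ

variable (k) in
/-- A pair `(φ, G)` over `Ω`: a Drinfeld module `φ` of rank two with `γ(T) = 1` and `J(φ) = J₀`,
and a `k[T]`-submodule `G` of its torsion that is isomorphic to `k[T]/(T^n)`. -/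
structure LevelPair (J₀ : Ω) (n : ℕ) where
  φ : DrinfeldModule Ω
  gamma_T : φ.l₀ = 1
  J_eq : φ.J k = J₀
  G : Submodule k[X] (φ.Points k)
  cyclic : Nonempty (G ≃ₗ[k[X]] k[X] ⧸ Ideal.span {(X : k[X]) ^ n})

namespace LevelPair

variable {J₀ : Ω} {n : ℕ}

/-- The subgroup `G` as a set of elements of `Ω`. -/
def pts (p : LevelPair k J₀ n) : Set Ω := {x | Module.AEval'.of (p.φ.opT k) x ∈ p.G}

/-- `c ∈ Ωˣ` is an isomorphism from `(φ, G)` to `(φ', G')`. -/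
def IsIsoBy (c : Ω) (p p' : LevelPair k J₀ n) : Prop :=
  c ≠ 0 ∧ (∀ x : Ω, c * p.φ.opT k x = p'.φ.opT k (c * x)) ∧ ∀ x : Ω, x ∈ p.pts ↔ c * x ∈ p'.pts

/-- `(φ, G)` and `(φ', G')` are isomorphic. -/
def IsIso (p p' : LevelPair k J₀ n) : Prop := ∃ c : Ω, IsIsoBy c p p'

/-- `(φ', G')` is the image `(φ^σ, σ(G))` of `(φ, G)` under the field automorphism `σ`. -/
def IsConj (σ : Ω ≃+* Ω) (p p' : LevelPair k J₀ n) : Prop :=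
  p'.φ.g = σ p.φ.g ∧ p'.φ.Δ = σ p.φ.Δ ∧ ∀ x : Ω, x ∈ p.pts ↔ σ x ∈ p'.pts

/-- The natural map `(φ, G) ↦ (φ, T^(n-m) G)` from level `T^n` to level `T^m`. -/
def degeneracy {m : ℕ} (h : m ≤ n) (p : LevelPair k J₀ n) : LevelPair k J₀ m where
  φ := p.φ
  gamma_T := p.gamma_T
  J_eq := p.J_eq
  G := p.G.map (LinearMap.lsmul k[X] (p.φ.Points k) (X ^ (n - m)))
  cyclic := p.cyclic.elim (exists_iso_map p.G h)

theorem mem_pts_degeneracy {m : ℕ} (h : m ≤ n) (p : LevelPair k J₀ n) (x : Ω) :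
    x ∈ (p.degeneracy h).pts ↔ ∃ y ∈ p.pts, (p.φ.opT k ^ (n - m)) y = x := by
  constructor
  · rintro ⟨y, hy, hyx⟩
    obtain ⟨y, rfl⟩ := (Module.AEval'.of (p.φ.opT k)).surjective y
    refine ⟨y, hy, (Module.AEval'.of (p.φ.opT k)).injective ?_⟩
    exact (of_pow (p.φ.opT k) _ _).symm.trans hyx
  · rintro ⟨y, hy, rfl⟩
    exact ⟨_, hy, of_pow (p.φ.opT k) _ _⟩

theorem mem_degeneracy_iff {m : ℕ} (h : m ≤ n) {p p' : LevelPair k J₀ n} (u : Ω ≃ Ω)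
    (hu : ∀ x, u (p.φ.opT k x) = p'.φ.opT k (u x)) (hG : ∀ x, x ∈ p.pts ↔ u x ∈ p'.pts) (x : Ω) :
    x ∈ (p.degeneracy h).pts ↔ u x ∈ (p'.degeneracy h).pts := by
  have hpow : ∀ (r : ℕ) (y : Ω), u ((p.φ.opT k ^ r) y) = (p'.φ.opT k ^ r) (u y) := by
    intro r
    induction r with
    | zero => intro y; rfl
    | succ r ih =>
      intro y
      rw [pow_succ, pow_succ, Module.End.mul_apply, Module.End.mul_apply, ih, hu]
  rw [mem_pts_degeneracy, mem_pts_degeneracy]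
  constructor
  · rintro ⟨y, hy, rfl⟩
    exact ⟨u y, (hG y).1 hy, (hpow _ _).symm⟩
  · rintro ⟨y, hy, hyx⟩
    refine ⟨u.symm y, (hG _).2 (by simpa using hy), u.injective ?_⟩
    rw [hpow, Equiv.apply_symm_apply, hyx]

theorem IsIso.degeneracy {m : ℕ} (h : m ≤ n) {p p' : LevelPair k J₀ n} (hp : IsIso p p') :
    IsIso (p.degeneracy h) (p'.degeneracy h) := by
  obtain ⟨c, hc, h1, h2⟩ := hp
  exact ⟨c, hc, h1, mem_degeneracy_iff h (Equiv.mulLeft₀ c hc) h1 h2⟩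

theorem IsConj.degeneracy {m : ℕ} (h : m ≤ n) {σ : Ω ≃+* Ω} {p p' : LevelPair k J₀ n}
    (hp : IsConj σ p p') : IsConj σ (p.degeneracy h) (p'.degeneracy h) := by
  obtain ⟨h1, h2, h3⟩ := hp
  refine ⟨h1, h2, mem_degeneracy_iff h σ.toEquiv (fun x => ?_) h3⟩
  simp [DrinfeldModule.opT, tau, h1, h2, p.gamma_T, p'.gamma_T, pow_two]

end LevelPair

/-- The linearized polynomial `P_x(Y) = x^(q-1) Y - Y^q`, which vanishes on `k x`. -/
def P (k : Type*) [Fintype k] (x Y : Ω) : Ω :=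
  x ^ (Fintype.card k - 1) * Y - Y ^ Fintype.card k

/-- The composite `P_{x_i} ∘ ⋯ ∘ P_{x_1}` (the identity for `i = 0`). -/
def chainP (k : Type*) [Fintype k] (x : ℕ → Ω) : ℕ → Ω → Ω
  | 0, Y => Y
  | i + 1, Y => P k (x (i + 1)) (chainP k x i Y)

/-- `x_1, …, x_n` are coordinates of the pair `(φ, G)` with `φ` normalized (`Δ = -1`): `x_1`
generates the group of `T`-torsion points in `G`, and `x_j = (P_{x_{j-1}} ∘ ⋯ ∘ P_{x_1})(y_j)` for
some `y_j ∈ G` with `φ_{T^(j-1)}(y_j) = x_1`. -/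
structure IsNormalizedCoords {J₀ : Ω} {n : ℕ} (p : LevelPair k J₀ n) (x : ℕ → Ω) : Prop where
  normalized : p.φ.Δ = -1
  x_one_mem : x 1 ∈ p.pts
  x_one_ne_zero : x 1 ≠ 0
  x_one_torsion : p.φ.opT k (x 1) = 0
  x_eq : ∀ j, 1 ≤ j → j ≤ n →
    ∃ y ∈ p.pts, (p.φ.opT k ^ (j - 1)) y = x 1 ∧ x j = chainP k x (j - 1) y

/-- `x_1, …, x_n` are the coordinates of a normalized pair isomorphic to `p`. -/
def IsCoords {J₀ : Ω} {n : ℕ} (p : LevelPair k J₀ n) (x : ℕ → Ω) : Prop :=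
  ∃ p' : LevelPair k J₀ n, LevelPair.IsIso p p' ∧ IsNormalizedCoords p' x

end Modules

section FunctionField

variable (k : Type*) [Field k] [Fintype k] (L : Type*) [Field L]
variable (Ω : Type*) [Field Ω] [Algebra k Ω] [Algebra L Ω] [Algebra (RatFunc L) Ω]
variable [IsScalarTower L (RatFunc L) Ω]

/-- The coordinate `J` of the `J`-line over `L`, as an element of the extension `Ω` of `L(J)`. -/
def genericJ : Ω := algebraMap (RatFunc L) Ω RatFunc.X

/-- The pairs `(φ, G)` of level `T^n` over `Ω` that lie over the generic point of the `J`-line.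
For a separable closure `Ω` of `L(J)`, their isomorphism classes are the geometric points of
`X_0(T^n)` over the generic point of `X(1)`. -/
abbrev GenericPair (n : ℕ) : Type _ := LevelPair k (genericJ L Ω) n

/-- The ring of rational functions over `L` on the modular curve `X_0(T^n)` (with `γ(T) = 1`), where
`Ω` is a separable closure of `L(J)`: the `Ω`-valued functions of the pairs `(φ, G)` with
`J(φ) = J` that depend only on the isomorphism class of the pair and commute with the Galois
group of `Ω` over `L(J)`. By Galois descent this is the `L(J)`-algebra of the generic fibre
of `X_0(T^n) → X(1)`. -/
def functionField (n : ℕ) : Subalgebra L (GenericPair k L Ω n → Ω) where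
  carrier := {f | (∀ p p', LevelPair.IsIso p p' → f p' = f p) ∧
    ∀ (σ : Ω ≃ₐ[RatFunc L] Ω) (p p'), LevelPair.IsConj σ.toRingEquiv p p' → f p' = σ (f p)}
  mul_mem' := by
    rintro a b ⟨ha, ha'⟩ ⟨hb, hb'⟩
    refine ⟨fun p p' h => ?_, fun σ p p' h => ?_⟩
    · simp [ha p p' h, hb p p' h]
    · simp [ha' σ p p' h, hb' σ p p' h]
  add_mem' := by
    rintro a b ⟨ha, ha'⟩ ⟨hb, hb'⟩
    refine ⟨fun p p' h => ?_, fun σ p p' h => ?_⟩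
    · simp [ha p p' h, hb p p' h]
    · simp [ha' σ p p' h, hb' σ p p' h]
  algebraMap_mem' := by
    intro r
    refine ⟨fun p p' _ => rfl, fun σ p p' _ => ?_⟩
    simp only [Pi.algebraMap_apply]
    rw [IsScalarTower.algebraMap_apply L (RatFunc L) Ω, AlgEquiv.commutes]

variable {k L Ω}

/-- Pullback of rational functions along `X_0(T^n) → X_0(T^m)`, `(φ, G) ↦ (φ, T^(n-m) G)`. -/
def pullback {m n : ℕ} (h : m ≤ n) : functionField k L Ω m →ₐ[L] functionField k L Ω n where
  toFun f := ⟨fun p => f.1 (p.degeneracy h), fun _ _ hp => f.2.1 _ _ (hp.degeneracy h),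
    fun σ _ _ hp => f.2.2 σ _ _ (hp.degeneracy h)⟩
  map_one' := rfl
  map_mul' _ _ := rfl
  map_zero' := rfl
  map_add' _ _ := rfl
  commutes' _ := rfl

/-- The rational function `w` is `x_1^(q^2-1)`. -/
def IsX1Power {n : ℕ} (w : functionField k L Ω n) : Prop :=
  ∀ p x, IsCoords p x → w.1 p = x 1 ^ (Fintype.card k ^ 2 - 1)

/-- The rational function `f` is `Z_j = z_j^(q-1)`, where `z_j = x_{j-1} x_j`. -/
def IsZ {n : ℕ} (j : ℕ) (f : functionField k L Ω n) : Prop :=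
  ∀ p x, IsCoords p x → f.1 p = (x (j - 1) * x j) ^ (Fintype.card k - 1)

end FunctionField

/-- The relations between `X_1 = x_1^(q^2-1)` and `X_j = Z_j` (`2 ≤ j ≤ n`), with denominators
cleared: `X_2 (1 + X_2)^(q-1) = X_1`, and
`X_{j+1} (1 + X_{j+1})^(q-1) (1 + X_j)^(q-1) = X_j^q` for `2 ≤ j ≤ n - 1`. -/
def relations (q : ℕ) (L : Type*) [Field L] (n : ℕ) : Set (MvPolynomial (Set.Icc 1 n) L) :=
  {r | ∃ a b : Set.Icc 1 n, (a : ℕ) = 1 ∧ (b : ℕ) = 2 ∧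
      r = MvPolynomial.X b * (1 + MvPolynomial.X b) ^ (q - 1) - MvPolynomial.X a} ∪
  {r | ∃ a b : Set.Icc 1 n, 2 ≤ (a : ℕ) ∧ (b : ℕ) = a + 1 ∧
      r = MvPolynomial.X b * (1 + MvPolynomial.X b) ^ (q - 1)
        * (1 + MvPolynomial.X a) ^ (q - 1) - MvPolynomial.X a ^ q}

end DrinfeldTower

end

/-! Write Q_x(Y) = x^(1-q) Y + Y^q (this is `dualP`). If x_1 is a nonzero T-torsion point of a
normalized φ, then φ_T = Q_{x_1} ∘ P_{x_1}, so P_{x_1} is an isogeny with kernel k x_1 from φ to the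
normalized module given by P_{x_1} ∘ Q_{x_1}. From T y_2 = x_1 it follows that x_2 = P_{x_1}(y_2)
satisfies Q_{x_1}(x_2) = x_1, and hence is T-torsion on that module. Iterating
(`ne_zero_and_chainP_opT`), the pair becomes a chain of such isogenies, with Q_{x_j}(x_{j+1}) = x_j
at each step and with G as the kernel of the composite.

Multiplied by x_j^q, this equation reads z_{j+1} (1 + Z_{j+1}) = x_j^(q+1). Its (q-1)-st power,
together with x_j^(q²-1) x_{j+1}^(q²-1) = Z_{j+1}^(q+1), gives the relations. Coordinates are unique
up to a (q²-1)-th root of unity c that multiplies x_j by c^(q^(j-1)). So x_1^(q²-1) and the Z_j are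
invariants of the isomorphism class, and they determine it (`IsCoords.isIso`).

There are no further relations: Z_j is a root of a monic polynomial of degree q over L(Z_{j+1}, …,
Z_n), and above the zero of Z_n every step is totally ramified, hence of degree q
(`natDegree_minpoly_tower`). So the polynomial ring modulo the relations embeds into Ω
(`ker_aeval_eq_span_relations`).

Consequently the invariants of any two pairs satisfy the same relations, and matching them gives a
field isomorphism. It fixes J, a rational function of x_1^(q²-1), and extends to an element of the
Galois group. The Galois group is therefore transitive on isomorphism classes
(`exists_isConj_isIso`), and evaluation at one pair identifies the function field with the field
generated by the values of the invariants (`evalEquiv`). The degree over level T^(n-1) comes from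
the same ramification argument run upwards for the inverses, above the pole of x_1^(q²-1). -/

noncomputable section

set_option linter.unusedSectionVars false

namespace DrinfeldTower

/-! ### Linearized polynomials and the factorization of φ_T. -/

section Linearized

variable {k Ω : Type*} [Field k] [Fintype k] [Field Ω] [Algebra k Ω]

local notation "q" => Fintype.card k

variable (k) in
theorem add_pow_card (x y : Ω) : (x + y) ^ q = x ^ q + y ^ q :=
  map_add (FiniteField.frobeniusAlgHom k Ω) x y

variable (k) in
theorem sub_pow_card (x y : Ω) : (x - y) ^ q = x ^ q - y ^ q :=
  map_sub (FiniteField.frobeniusAlgHom k Ω) x y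

theorem smul_pow_card (a : k) (x : Ω) : (a • x) ^ q = a • x ^ q :=
  map_smul (FiniteField.frobeniusAlgHom k Ω) a x

variable (k) in
theorem pow_card_eq_mul (x : Ω) : x ^ q = x ^ (q - 1) * x := by
  rw [← pow_succ, Nat.sub_add_cancel Fintype.card_pos]

variable (k) in
theorem card_sub_one_mul_card_add_one : (q - 1) * (q + 1) = q ^ 2 - 1 := by
  rw [mul_comm, ← Nat.sq_sub_sq q 1, one_pow]

variable (k) in
theorem pow_card_sq_eq_mul (x : Ω) : x ^ q ^ 2 = x ^ (q ^ 2 - 1) * x := by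
  rw [← pow_succ, Nat.sub_add_cancel (pow_pos Fintype.card_pos 2)]

/-- The fixed points of the `q`-power Frobenius are the elements of `k`. -/
theorem exists_algebraMap_eq_of_pow_card {x : Ω} (hx : x ^ q = x) :
    ∃ a : k, algebraMap k Ω a = x := by
  have hq : 1 < q := Fintype.one_lt_card
  have h0 : (X ^ q - X : k[X]) ≠ 0 := FiniteField.X_pow_card_sub_X_ne_zero k hq
  have hs : (X ^ q - X : k[X]).Splits := by
    rw [splits_iff_card_roots, FiniteField.roots_X_pow_card_sub_X,
      FiniteField.X_pow_card_sub_X_natDegree_eq k hq]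
    rfl
  exact hs.mem_range_of_isRoot h0 (by simp [hx])

theorem opT_apply (φ : DrinfeldModule Ω) (y : Ω) :
    φ.opT k y = φ.l₀ * y + φ.g * y ^ q + φ.Δ * (y ^ q) ^ q := by
  simp [DrinfeldModule.opT, tau, pow_two]

theorem P_sub (x y z : Ω) : P k x (y - z) = P k x y - P k x z := by
  simp only [P, sub_pow_card]; ring

theorem P_smul (x : Ω) (a : k) (y : Ω) : P k x (a • y) = a • P k x y := by
  simp only [P, smul_pow_card, mul_smul_comm, smul_sub]

theorem P_self (x : Ω) : P k x x = 0 := by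
  rw [P, pow_card_eq_mul k x, sub_self]

theorem exists_smul_of_P_eq_zero {x y : Ω} (hx : x ≠ 0) (h : P k x y = 0) :
    ∃ a : k, y = a • x := by
  rw [P, sub_eq_zero] at h
  obtain ⟨a, ha⟩ := exists_algebraMap_eq_of_pow_card (k := k) (x := y / x) (by
    rw [div_pow, ← h, pow_card_eq_mul k x]
    field_simp)
  exact ⟨a, by rw [Algebra.smul_def, ha, div_mul_cancel₀ _ hx]⟩

theorem chainP_sub (x : ℕ → Ω) (i : ℕ) (y z : Ω) :
    chainP k x i (y - z) = chainP k x i y - chainP k x i z := by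
  induction i with
  | zero => rfl
  | succ i ih => simp only [chainP, ih, P_sub]

theorem chainP_smul (x : ℕ → Ω) (i : ℕ) (a : k) (y : Ω) :
    chainP k x i (a • y) = a • chainP k x i y := by
  induction i with
  | zero => rfl
  | succ i ih => simp only [chainP, ih, P_smul]

theorem chainP_congr {x x' : ℕ → Ω} {i : ℕ} (h : ∀ j, 1 ≤ j → j ≤ i → x j = x' j) (y : Ω) :
    chainP k x i y = chainP k x' i y := by
  induction i with
  | zero => rfl
  | succ i ih =>
    simp only [chainP, ih fun j h1 h2 => h j h1 (h2.trans i.le_succ), h (i + 1) (by simp) le_rfl]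

variable (k) in
/-- The linearized polynomial `x^(1-q) Y + Y^q`. Up to the order of the factors, its composite
with `P_x` is a normalized Drinfeld module with torsion point `x`. -/
def dualP (x Y : Ω) : Ω := (x ^ (q - 1))⁻¹ * Y + Y ^ q

/-- With s = x^(q-1), the torsion condition says exactly g = s^q - s⁻¹, which is the middle
coefficient of the composite. -/
theorem dualP_P {x g : Ω} (hx : x ≠ 0) (h : x + g * x ^ q - (x ^ q) ^ q = 0) (y : Ω) :
    dualP k x (P k x y) = y + g * y ^ q - (y ^ q) ^ q := by
  have hs : x ^ (q - 1) ≠ 0 := pow_ne_zero _ hx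
  rw [pow_card_eq_mul k x, mul_pow, pow_card_eq_mul k x] at h
  rw [dualP, P, sub_pow_card, mul_pow]
  generalize x ^ (q - 1) = s at *
  have hg : g = s ^ q - s⁻¹ := by
    field_simp
    apply mul_right_cancel₀ hx
    linear_combination h
  rw [hg]
  field_simp
  ring

/-- Exchanging the factors gives the target of the isogeny P_x: again normalized with γ(T) = 1, now
with g = s - s^(-q). -/
theorem P_dualP {x : Ω} (hx : x ≠ 0) (y : Ω) :
    P k x (dualP k x y) =
      y + (x ^ (q - 1) - (x ^ (q - 1))⁻¹ ^ q) * y ^ q - (y ^ q) ^ q := by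
  have hs : x ^ (q - 1) ≠ 0 := pow_ne_zero _ hx
  rw [dualP, P, add_pow_card, mul_pow]
  generalize x ^ (q - 1) = s at *
  field_simp
  ring

end Linearized

/-! ### Cyclic submodules and their generators. -/

namespace LevelPair

variable {k Ω : Type*} [Field k] [Fintype k] [Field Ω] [Algebra k Ω] {J₀ : Ω} {n : ℕ}

local notation "q" => Fintype.card k

theorem mem_pts {p : LevelPair k J₀ n} {x : Ω} :
    x ∈ p.pts ↔ Module.AEval'.of (p.φ.opT k) x ∈ p.G := Iff.rfl

/-- Translates the abstract isomorphism with k[T]/(T^n) into divisibility by T^n; the generator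
corresponds to the class of 1. -/
theorem exists_generator (p : LevelPair k J₀ n) : ∃ y : Ω,
    (∀ x, x ∈ p.pts ↔ ∃ a : k[X], aeval (p.φ.opT k) a y = x) ∧
    ∀ a : k[X], aeval (p.φ.opT k) a y = 0 ↔ X ^ n ∣ a := by
  obtain ⟨e⟩ := p.cyclic
  let I := Ideal.span {(X : k[X]) ^ n}
  let y : Ω := (Module.AEval'.of (p.φ.opT k)).symm (e.symm (Submodule.Quotient.mk 1))
  have hy : ∀ a : k[X], Module.AEval'.of (p.φ.opT k) (aeval (p.φ.opT k) a y) =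
      (e.symm (Submodule.Quotient.mk a) : p.φ.Points k) := by
    intro a
    have : (Submodule.Quotient.mk a : k[X] ⧸ I) = a • Submodule.Quotient.mk 1 := by
      rw [← Submodule.Quotient.mk_smul, smul_eq_mul, mul_one]
    rw [this, map_smul]
    rfl
  refine ⟨y, fun x => ⟨fun hx => ?_, ?_⟩, fun a => ?_⟩
  · obtain ⟨a, ha⟩ := Submodule.Quotient.mk_surjective _ (e ⟨_, hx⟩)
    refine ⟨a, (Module.AEval'.of (p.φ.opT k)).injective ?_⟩
    rw [hy, ha, LinearEquiv.symm_apply_apply]; rfl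
  · rintro ⟨a, rfl⟩
    rw [mem_pts, hy]
    exact Subtype.prop _
  · rw [← Ideal.mem_span_singleton, ← Submodule.Quotient.mk_eq_zero I,
      ← LinearEquiv.map_eq_zero_iff e.symm, ← Subtype.coe_inj, ← hy]
    exact (LinearEquiv.map_eq_zero_iff _).symm

theorem exists_of_generator (φ : DrinfeldModule Ω) (h1 : φ.l₀ = 1) (hJ : φ.J k = J₀) (y : Ω)
    (hy : ∀ a : k[X], aeval (φ.opT k) a y = 0 ↔ X ^ n ∣ a) :
    ∃ p : LevelPair k J₀ n, p.φ = φ ∧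
      ∀ x, x ∈ p.pts ↔ ∃ a : k[X], aeval (φ.opT k) a y = x := by
  let y' : φ.Points k := Module.AEval'.of (φ.opT k) y
  let F : k[X] →ₗ[k[X]] φ.Points k := LinearMap.toSpanSingleton k[X] _ y'
  have hF : ∀ a, F a = Module.AEval'.of (φ.opT k) (aeval (φ.opT k) a y) := fun a => rfl
  have hker : LinearMap.ker F = Ideal.span {(X : k[X]) ^ n} := by
    ext a
    rw [LinearMap.mem_ker, hF, LinearEquiv.map_eq_zero_iff, hy, Ideal.mem_span_singleton]
  refine ⟨⟨φ, h1, hJ, LinearMap.range F, ⟨F.quotKerEquivRange.symm.trans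
    (Submodule.quotEquivOfEq _ _ hker)⟩⟩, rfl, fun x => ?_⟩
  rw [mem_pts]
  change Module.AEval'.of (φ.opT k) x ∈ LinearMap.range F ↔ _
  simp only [LinearMap.mem_range, hF, (Module.AEval'.of (φ.opT k)).injective.eq_iff]

theorem aeval_apply_of_comm {f f' : Module.End k Ω} {u : Ω →ₗ[k] Ω}
    (hu : ∀ x, u (f x) = f' (u x)) (a : k[X]) (x : Ω) : u (aeval f a x) = aeval f' a (u x) := by
  induction a using Polynomial.induction_on generalizing x with
  | C a => simp
  | add a b ha hb => simp [ha, hb]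
  | monomial m a h =>
    have := h (f x)
    simpa [pow_succ, hu] using this

/-- Pairs can be transported along `k`-linear automorphisms of `Ω` that carry one Drinfeld module
into another. -/
theorem exists_transport (p : LevelPair k J₀ n) (φ : DrinfeldModule Ω) (h1 : φ.l₀ = 1)
    (hJ : φ.J k = J₀) (u : Ω ≃ₗ[k] Ω) (hu : ∀ x, u (p.φ.opT k x) = φ.opT k (u x)) :
    ∃ p' : LevelPair k J₀ n, p'.φ = φ ∧ ∀ x, x ∈ p.pts ↔ u x ∈ p'.pts := by
  obtain ⟨y, hy1, hy2⟩ := p.exists_generator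
  have hc : ∀ (a : k[X]) (x : Ω), u (aeval (p.φ.opT k) a x) = aeval (φ.opT k) a (u x) :=
    aeval_apply_of_comm (u := u.toLinearMap) hu
  obtain ⟨p', hp', h⟩ := exists_of_generator φ h1 hJ (u y) (n := n) fun a => by
    rw [← hc, LinearEquiv.map_eq_zero_iff, hy2]
  refine ⟨p', hp', fun x => ?_⟩
  rw [h, hy1]
  simp only [← hc, u.injective.eq_iff]

theorem sub_mem_pts {p : LevelPair k J₀ n} {x y : Ω} (hx : x ∈ p.pts) (hy : y ∈ p.pts) :
    x - y ∈ p.pts := by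
  rw [mem_pts, map_sub]
  exact p.G.sub_mem hx hy

theorem opT_pow_mem_pts {p : LevelPair k J₀ n} {x : Ω} (hx : x ∈ p.pts) (r : ℕ) :
    (p.φ.opT k ^ r) x ∈ p.pts := by
  rw [mem_pts, ← of_pow]
  exact p.G.smul_mem _ hx

theorem smul_mem_pts {p : LevelPair k J₀ n} {x : Ω} (hx : x ∈ p.pts) (a : k) :
    a • x ∈ p.pts := by
  have : Module.AEval'.of (p.φ.opT k) (a • x) = (C a : k[X]) • Module.AEval'.of (p.φ.opT k) x := by
    rw [← Module.AEval.of_aeval_smul]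
    simp
  rw [mem_pts, this]
  exact p.G.smul_mem _ hx

theorem aeval_X_pow_mul_apply (f : Module.End k Ω) (r : ℕ) (a : k[X]) (y : Ω) :
    aeval f (X ^ r * a) y = (f ^ r) (aeval f a y) := by
  simp

theorem exists_opT_pow_eq {p : LevelPair k J₀ n} {x : Ω} (hx : x ∈ p.pts) {j : ℕ} (hj : j ≤ n)
    (h : (p.φ.opT k ^ j) x = 0) : ∃ z ∈ p.pts, (p.φ.opT k ^ (n - j)) z = x := by
  obtain ⟨y, hy1, hy2⟩ := p.exists_generator
  obtain ⟨a, rfl⟩ := (hy1 x).1 hx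
  rw [← aeval_X_pow_mul_apply, hy2] at h
  -- In k[T]/(T^n) the T^j-torsion consists of the multiples of T^(n-j): cancel T^j in T^n ∣ T^j a.
  have hn : (X : k[X]) ^ n = X ^ j * X ^ (n - j) := by rw [← pow_add, Nat.add_sub_cancel' hj]
  rw [hn] at h
  obtain ⟨b, rfl⟩ := (mul_dvd_mul_iff_left (pow_ne_zero _ X_ne_zero)).1 h
  exact ⟨_, (hy1 _).2 ⟨b, rfl⟩, (aeval_X_pow_mul_apply _ _ _ _).symm⟩

theorem opT_pow_eq_zero {p : LevelPair k J₀ n} {x : Ω} (hx : x ∈ p.pts) :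
    (p.φ.opT k ^ n) x = 0 := by
  obtain ⟨y, hy1, hy2⟩ := p.exists_generator
  obtain ⟨a, rfl⟩ := (hy1 x).1 hx
  rw [← aeval_X_pow_mul_apply, hy2]
  exact dvd_mul_right _ _

/-- The `T`-torsion of `G` is one-dimensional over `k`. -/
theorem exists_smul_of_opT_eq_zero {p : LevelPair k J₀ n} {x y : Ω} (hx : x ∈ p.pts)
    (hx0 : x ≠ 0) (hxT : p.φ.opT k x = 0) (hy : y ∈ p.pts) (hyT : p.φ.opT k y = 0) :
    ∃ a : k, y = a • x := by
  obtain ⟨t, ht1, ht2⟩ := p.exists_generator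
  rcases n.eq_zero_or_pos with rfl | hn
  · exact absurd (by simpa using opT_pow_eq_zero hx) hx0
  have key : ∀ z ∈ p.pts, p.φ.opT k z = 0 → ∃ a : k, z = a • (p.φ.opT k ^ (n - 1)) t := by
    intro z hz hzT
    obtain ⟨w, hw, rfl⟩ := exists_opT_pow_eq hz hn (by simpa using hzT)
    obtain ⟨b, rfl⟩ := (ht1 w).1 hw
    refine ⟨b.coeff 0, ?_⟩
    rw [← sub_eq_zero, ← map_smul, ← map_sub]
    have : aeval (p.φ.opT k) b t - b.coeff 0 • t = aeval (p.φ.opT k) (b - C (b.coeff 0)) t := by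
      simp
    rw [this, ← aeval_X_pow_mul_apply, ht2]
    obtain ⟨m, rfl⟩ := Nat.exists_eq_add_of_lt hn
    rw [zero_add, Nat.add_sub_cancel, pow_succ]
    exact mul_dvd_mul_left _ (X_dvd_sub_C)
  obtain ⟨a, ha⟩ := key x hx hxT
  obtain ⟨b, hb⟩ := key y hy hyT
  have ha0 : a ≠ 0 := by rintro rfl; exact hx0 (by rw [ha, zero_smul])
  exact ⟨b * a⁻¹, by rw [hb, ha, smul_smul, mul_assoc, inv_mul_cancel₀ ha0, mul_one]⟩

end LevelPair

/-! ### Coordinates of normalized pairs as chains of isogenies. -/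

section NormalizedCoordinates

variable {k Ω : Type*} [Field k] [Fintype k] [Field Ω] [Algebra k Ω] {J₀ : Ω} {n : ℕ}
variable {p p' : LevelPair k J₀ n} {x x' : ℕ → Ω}

local notation "q" => Fintype.card k

open LevelPair

namespace IsNormalizedCoords

theorem opT_eq (hx : IsNormalizedCoords p x) (y : Ω) :
    p.φ.opT k y = y + p.φ.g * y ^ q - (y ^ q) ^ q := by
  rw [opT_apply, p.gamma_T, hx.normalized]; ring

theorem torsion_eq (hx : IsNormalizedCoords p x) :
    x 1 + p.φ.g * x 1 ^ q - (x 1 ^ q) ^ q = 0 :=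
  (hx.opT_eq (x 1)).symm.trans hx.x_one_torsion

/-- Induction on j. If T^(j+1) y = 0, then T^j y = a x_1 with a in k, so y - a y_{j+1} is killed by
T^j. Hence the chain of length j maps y to a x_{j+1}, which P_{x_{j+1}} kills. No nonvanishing of
the later x_j is needed here. -/
theorem chainP_eq_zero (hx : IsNormalizedCoords p x) {j : ℕ} (hj : j ≤ n) {y : Ω}
    (hy : y ∈ p.pts) (h : (p.φ.opT k ^ j) y = 0) : chainP k x j y = 0 := by
  induction j generalizing y with
  | zero => simpa [chainP] using h
  | succ j ih =>
    obtain ⟨a, ha⟩ := exists_smul_of_opT_eq_zero hx.x_one_mem hx.x_one_ne_zero hx.x_one_torsion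
      (opT_pow_mem_pts hy j) (by rwa [pow_succ'] at h)
    obtain ⟨z, hz, hz1, hz2⟩ := hx.x_eq (j + 1) (by simp) hj
    rw [Nat.add_sub_cancel] at hz1 hz2
    have := ih (by omega) (sub_mem_pts hy (smul_mem_pts hz a))
      (by rw [map_sub, map_smul, ha, hz1, sub_self])
    rw [chainP_sub, chainP_smul, ← hz2, sub_eq_zero] at this
    rw [chainP, this, P_smul, P_self, smul_zero]

/-- Two choices of y_{j+1} differ by T^j-torsion, so x_{j+1} depends only on x_1, …, x_j. -/
theorem chainP_eq (hx : IsNormalizedCoords p x) {j : ℕ} (hj : j + 1 ≤ n) {y : Ω}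
    (hy : y ∈ p.pts) (h : (p.φ.opT k ^ j) y = x 1) : chainP k x j y = x (j + 1) := by
  obtain ⟨z, hz, hz1, hz2⟩ := hx.x_eq (j + 1) (by simp) hj
  rw [Nat.add_sub_cancel] at hz1 hz2
  rw [hz2, ← sub_eq_zero, ← chainP_sub]
  exact hx.chainP_eq_zero (by omega) (sub_mem_pts hy hz) (by rw [map_sub, h, hz1, sub_self])

/-- T y_{j+2} is an admissible choice of y_{j+1}. The factorization hypothesis is separated out
because it is proved in the same induction that uses this lemma. -/
theorem dualP_eq_of_chainP (hx : IsNormalizedCoords p x) {j : ℕ} (hj : j + 2 ≤ n)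
    (h : ∀ y, chainP k x j (p.φ.opT k y) = dualP k (x (j + 1)) (chainP k x (j + 1) y)) :
    dualP k (x (j + 1)) (x (j + 2)) = x (j + 1) := by
  obtain ⟨y, hy, hy1, hy2⟩ := hx.x_eq (j + 2) (by simp) hj
  rw [show j + 2 - 1 = j + 1 from rfl] at hy1 hy2
  rw [hy2, ← h]
  refine hx.chainP_eq (by omega) (by simpa using opT_pow_mem_pts hy 1) ?_
  rw [← hy1, pow_succ]
  rfl

/-- `P_{x_j} ∘ ⋯ ∘ P_{x_1}` is an isogeny from `φ` to a normalized Drinfeld module with torsion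
point `x_{j+1}`. -/
theorem ne_zero_and_chainP_opT (hx : IsNormalizedCoords p x) {j : ℕ} (hj : j + 1 ≤ n) :
    x (j + 1) ≠ 0 ∧
      ∀ y, chainP k x j (p.φ.opT k y) = dualP k (x (j + 1)) (chainP k x (j + 1) y) := by
  induction j with
  | zero =>
    refine ⟨hx.x_one_ne_zero, fun y => ?_⟩
    rw [chainP, chainP, chainP, dualP_P hx.x_one_ne_zero hx.torsion_eq, hx.opT_eq]
  | succ j ih =>
    obtain ⟨h0, h⟩ := ih (by omega)
    have hd := hx.dualP_eq_of_chainP hj h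
    have h0' : x (j + 2) ≠ 0 := by
      intro h0'
      rw [h0'] at hd
      exact h0 (by rw [← hd]; simp [dualP])
    refine ⟨h0', fun y => ?_⟩
    -- Since P_{x_{j+1}} kills x_{j+1} = Q_{x_{j+1}}(x_{j+2}), the point x_{j+2} is T-torsion on the
    -- next module, which therefore factors through P_{x_{j+2}}.
    have ht := P_dualP (k := k) h0 (x (j + 2))
    rw [hd, P_self] at ht
    rw [chainP, h, P_dualP h0, ← dualP_P h0' ht.symm, ← chainP]

theorem ne_zero (hx : IsNormalizedCoords p x) {j : ℕ} (h1 : 1 ≤ j) (hj : j ≤ n) : x j ≠ 0 := by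
  obtain ⟨j, rfl⟩ := Nat.exists_eq_add_of_le' h1
  exact (hx.ne_zero_and_chainP_opT hj).1

theorem dualP_eq (hx : IsNormalizedCoords p x) {j : ℕ} (h1 : 1 ≤ j) (hj : j + 1 ≤ n) :
    dualP k (x j) (x (j + 1)) = x j := by
  obtain ⟨j, rfl⟩ := Nat.exists_eq_add_of_le' h1
  exact hx.dualP_eq_of_chainP hj (hx.ne_zero_and_chainP_opT (by omega)).2

/-- Since x_{j+1} ≠ 0, the kernel of P_{x_{j+1}} is the line k x_{j+1}, so subtracting a multiple of
y_{j+1} shortens the chain. Together with `chainP_eq_zero` this recovers G from its coordinates. -/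
theorem mem_pts_of_chainP_eq_zero (hx : IsNormalizedCoords p x) {j : ℕ} (hj : j ≤ n) {y : Ω}
    (h : chainP k x j y = 0) : y ∈ p.pts := by
  induction j generalizing y with
  | zero =>
    rw [chainP] at h
    rw [h, ← sub_self (x 1)]
    exact sub_mem_pts hx.x_one_mem hx.x_one_mem
  | succ j ih =>
    obtain ⟨a, ha⟩ := exists_smul_of_P_eq_zero (hx.ne_zero (by simp) hj) h
    obtain ⟨z, hz, -, hz2⟩ := hx.x_eq (j + 1) (by simp) hj
    rw [Nat.add_sub_cancel] at hz2
    have := ih (y := y - a • z) (by omega) (by rw [chainP_sub, chainP_smul, ha, hz2, sub_self])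
    simpa using sub_mem_pts this (smul_mem_pts hz (-a))

theorem mem_pts_iff (hx : IsNormalizedCoords p x) {y : Ω} : y ∈ p.pts ↔ chainP k x n y = 0 :=
  ⟨fun h => hx.chainP_eq_zero le_rfl h (opT_pow_eq_zero h), hx.mem_pts_of_chainP_eq_zero le_rfl⟩

theorem g_mul_eq (hx : IsNormalizedCoords p x) :
    p.φ.g * x 1 ^ (q - 1) = x 1 ^ (q ^ 2 - 1) - 1 := by
  have h := hx.torsion_eq
  rw [← pow_mul, ← pow_two, pow_card_sq_eq_mul, pow_card_eq_mul k (x 1)] at h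
  apply mul_right_cancel₀ hx.x_one_ne_zero
  linear_combination h

/-- The torsion equation for x_1 expresses g, and with it J = -g^(q+1), through x_1. -/
theorem J_mul_eq (hx : IsNormalizedCoords p x) :
    J₀ * x 1 ^ (q ^ 2 - 1) = -(x 1 ^ (q ^ 2 - 1) - 1) ^ (q + 1) := by
  have hJ := p.J_eq
  rw [DrinfeldModule.J, hx.normalized] at hJ
  rw [← hx.g_mul_eq, mul_pow, ← pow_mul, card_sub_one_mul_card_add_one]
  linear_combination -x 1 ^ (q ^ 2 - 1) * hJ

theorem eq_of_x_one_eq (hx : IsNormalizedCoords p x) (hx' : IsNormalizedCoords p x')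
    (h : x' 1 = x 1) {j : ℕ} (h1 : 1 ≤ j) (hj : j ≤ n) : x' j = x j := by
  induction j using Nat.strong_induction_on with
  | _ j ih =>
    obtain ⟨y, hy, hy1, hy2⟩ := hx'.x_eq j h1 hj
    obtain ⟨j, rfl⟩ := Nat.exists_eq_add_of_le' h1
    rw [Nat.add_sub_cancel] at hy1 hy2
    rw [hy2, chainP_congr fun i hi hij => ih i (by omega) hi (by omega)]
    exact hx.chainP_eq hj hy (hy1.trans h)

end IsNormalizedCoords

theorem P_mul (c x y : Ω) : P k (c * x) (c * y) = c ^ q * P k x y := by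
  rw [P, P, mul_pow, mul_pow, pow_card_eq_mul k c]; ring

/-- P_x(Y) is homogeneous of degree q in (x, Y); this is why an isomorphism c acts on x_{j+1} with
weight q^j. -/
theorem chainP_mul {c : Ω} (h : ∀ j, x' (j + 1) = c ^ q ^ j * x (j + 1)) (i : ℕ) (y : Ω) :
    chainP k x' i (c * y) = c ^ q ^ i * chainP k x i y := by
  induction i with
  | zero => simp [chainP]
  | succ i ih => rw [chainP, ih, h, P_mul, chainP, ← pow_mul, ← pow_succ]

theorem map_chainP (σ : Ω ≃+* Ω) (x : ℕ → Ω) (i : ℕ) (y : Ω) :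
    σ (chainP k x i y) = chainP k (fun j => σ (x j)) i (σ y) := by
  induction i with
  | zero => rfl
  | succ i ih => simp [chainP, P, ih]

theorem map_opT_pow {u : Ω → Ω} {f f' : Module.End k Ω} (hu : ∀ x, u (f x) = f' (u x)) (r : ℕ)
    (y : Ω) : u ((f ^ r) y) = (f' ^ r) (u y) := by
  induction r generalizing y with
  | zero => rfl
  | succ r ih => rw [pow_succ, pow_succ, Module.End.mul_apply, Module.End.mul_apply, ih, hu]

theorem IsNormalizedCoords.of_isIsoBy (hx : IsNormalizedCoords p x) {c : Ω}
    (h : IsIsoBy c p p') (hΔ : p'.φ.Δ = -1) (hx' : ∀ j, x' (j + 1) = c ^ q ^ j * x (j + 1)) :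
    IsNormalizedCoords p' x' := by
  obtain ⟨hc, hT, hG⟩ := h
  have h1 : x' 1 = c * x 1 := by simpa using hx' 0
  refine ⟨hΔ, ?_, ?_, ?_, fun j hj hjn => ?_⟩
  · rw [h1, ← hG]; exact hx.x_one_mem
  · rw [h1]; exact mul_ne_zero hc hx.x_one_ne_zero
  · rw [h1, ← hT, hx.x_one_torsion, mul_zero]
  · obtain ⟨y, hy, hy1, hy2⟩ := hx.x_eq j hj hjn
    obtain ⟨j, rfl⟩ := Nat.exists_eq_add_of_le' hj
    rw [Nat.add_sub_cancel] at hy1 hy2 ⊢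
    refine ⟨c * y, (hG y).1 hy, ?_, ?_⟩
    · rw [← map_opT_pow (u := fun y => c * y) hT, hy1, h1]
    · rw [chainP_mul hx', hx', hy2]

theorem LevelPair.IsConj.map_opT {σ : Ω ≃+* Ω} (h : IsConj σ p p') (y : Ω) :
    σ (p.φ.opT k y) = p'.φ.opT k (σ y) := by
  simp [opT_apply, h.1, h.2.1, p.gamma_T, p'.gamma_T]

theorem IsNormalizedCoords.of_isConj (hx : IsNormalizedCoords p x) {σ : Ω ≃+* Ω}
    (h : IsConj σ p p') : IsNormalizedCoords p' (fun j => σ (x j)) := by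
  refine ⟨?_, ?_, ?_, ?_, fun j hj hjn => ?_⟩
  · rw [h.2.1, hx.normalized]; simp
  · exact (h.2.2 _).1 hx.x_one_mem
  · simpa using hx.x_one_ne_zero
  · rw [← IsConj.map_opT h, hx.x_one_torsion, map_zero]
  · obtain ⟨y, hy, hy1, hy2⟩ := hx.x_eq j hj hjn
    refine ⟨σ y, (h.2.2 _).1 hy, ?_, ?_⟩
    · rw [← map_opT_pow (IsConj.map_opT h), hy1]
    · rw [hy2, map_chainP]

/-- `chainP` takes a whole sequence but reads only its first terms, so a new term can be inserted by
`Function.update` without disturbing the earlier ones. -/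
theorem exists_chainP_sequence (y : ℕ → Ω) (m : ℕ) :
    ∃ x : ℕ → Ω, ∀ j < m, x (j + 1) = chainP k x j (y (j + 1)) := by
  induction m with
  | zero => exact ⟨0, by simp⟩
  | succ m ih =>
    obtain ⟨x, hx⟩ := ih
    have hc : ∀ j ≤ m, ∀ z y,
        chainP k (Function.update x (m + 1) z) j y = chainP k x j y := by
      intro j hj z y
      refine chainP_congr (fun i _ hi => ?_) y
      exact Function.update_of_ne (by omega) _ _
    refine ⟨Function.update x (m + 1) (chainP k x m (y (m + 1))), fun j hj => ?_⟩
    rw [hc j (by omega)]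
    rcases eq_or_ne j m with rfl | hjm
    · rw [Function.update_self]
    · rw [Function.update_of_ne (by omega), hx j (by omega)]

/-- Every normalized pair of positive level has coordinates. -/
theorem exists_isNormalizedCoords (hn : 1 ≤ n) (p : LevelPair k J₀ n) (hp : p.φ.Δ = -1) :
    ∃ x, IsNormalizedCoords p x := by
  obtain ⟨t, ht1, ht2⟩ := p.exists_generator
  have ht : ∀ r, (p.φ.opT k ^ r) t ∈ p.pts := fun r => (ht1 _).2 ⟨X ^ r, by simp⟩
  obtain ⟨x, hx⟩ := exists_chainP_sequence (k := k) (fun j => (p.φ.opT k ^ (n - j)) t) n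
  have h1 : x 1 = (p.φ.opT k ^ (n - 1)) t := hx 0 hn
  refine ⟨x, hp, h1 ▸ ht _, ?_, ?_, fun j hj hjn => ?_⟩
  · rw [h1]
    intro h0
    have := (ht2 (X ^ (n - 1))).1 (by simpa using h0)
    rw [pow_dvd_pow_iff X_ne_zero not_isUnit_X] at this
    omega
  · rw [h1, ← Module.End.mul_apply, ← pow_succ', Nat.sub_add_cancel hn]
    exact opT_pow_eq_zero (by simpa using ht 0)
  · obtain ⟨j, rfl⟩ := Nat.exists_eq_add_of_le' hj
    refine ⟨_, ht (n - (j + 1)), ?_, hx j (by omega)⟩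
    rw [h1, ← Module.End.mul_apply, ← pow_add, Nat.add_sub_cancel,
      show j + (n - (j + 1)) = n - 1 by omega]

end NormalizedCoordinates

/-! ### Isomorphisms, uniqueness of coordinates, the relations and the invariants. -/

section Coordinates

variable {k Ω : Type*} [Field k] [Fintype k] [Field Ω] [Algebra k Ω] {J₀ : Ω} {n : ℕ}
variable {p p' p'' : LevelPair k J₀ n} {x x' : ℕ → Ω}

local notation "q" => Fintype.card k

open LevelPair

theorem LevelPair.IsIsoBy.symm {c : Ω} (h : IsIsoBy c p p') : IsIsoBy c⁻¹ p' p := by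
  obtain ⟨hc, hT, hG⟩ := h
  refine ⟨inv_ne_zero hc, fun x => ?_, fun x => ?_⟩
  · rw [inv_mul_eq_iff_eq_mul₀ hc, hT, mul_inv_cancel_left₀ hc]
  · rw [hG, mul_inv_cancel_left₀ hc]

theorem LevelPair.IsIsoBy.trans {c d : Ω} (h : IsIsoBy c p p') (h' : IsIsoBy d p' p'') :
    IsIsoBy (d * c) p p'' := by
  refine ⟨mul_ne_zero h'.1 h.1, fun x => ?_, fun x => ?_⟩
  · rw [mul_assoc, h.2.1, h'.2.1, mul_assoc]
  · rw [h.2.2, h'.2.2, mul_assoc]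

theorem LevelPair.IsIso.symm (h : IsIso p p') : IsIso p' p :=
  h.elim fun _ hc => ⟨_, hc.symm⟩

theorem LevelPair.IsIso.trans (h : IsIso p p') (h' : IsIso p' p'') : IsIso p p'' :=
  h.elim fun _ hc => h'.elim fun _ hd => ⟨_, hc.trans hd⟩

theorem LevelPair.IsIsoBy.of_algebraMap {a : k} (ha : a ≠ 0) (p : LevelPair k J₀ n) :
    IsIsoBy (algebraMap k Ω a) p p := by
  refine ⟨by simpa using ha, fun x => ?_, fun x => ?_⟩
  · rw [← Algebra.smul_def, ← Algebra.smul_def, map_smul]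
  · rw [← Algebra.smul_def]
    refine ⟨fun h => smul_mem_pts h a, fun h => ?_⟩
    simpa [smul_smul, ha] using smul_mem_pts h a⁻¹

/-- An isomorphism between normalized pairs is a `(q² - 1)`-th root of unity. -/
theorem LevelPair.IsIsoBy.pow_eq_one [Infinite Ω] {c : Ω} (h : IsIsoBy c p p')
    (hp : p.φ.Δ = -1) (hp' : p'.φ.Δ = -1) : c ^ (q ^ 2 - 1) = 1 := by
  obtain ⟨hc, hT, -⟩ := h
  have hq : 1 < q := Fintype.one_lt_card
  -- Both operators agree at every point of the infinite field Ω, so their coefficients agree; the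
  -- one at X^(q²) yields c^(q²) = c.
  let F : Polynomial Ω := C (c * p.φ.g - p'.φ.g * c ^ q) * X ^ q + C (c ^ q ^ 2 - c) * X ^ q ^ 2
  have hF : F = 0 := by
    refine Polynomial.funext fun y => ?_
    have := hT y
    rw [opT_apply, opT_apply, p.gamma_T, p'.gamma_T, hp, hp', mul_pow, mul_pow, ← pow_mul,
      ← pow_mul, ← pow_two] at this
    simp only [F, eval_add, eval_mul, eval_C, eval_pow, eval_X, eval_zero]
    linear_combination this
  have h2 := congrArg (fun f : Polynomial Ω => f.coeff (q ^ 2)) hF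
  have hne : q ^ 2 ≠ q := by nlinarith
  simp only [F, coeff_add, coeff_C_mul, coeff_X_pow, hne, if_true, if_false, coeff_zero, mul_zero,
    mul_one, zero_add, sub_eq_zero] at h2
  apply mul_right_cancel₀ hc
  rw [← pow_card_sq_eq_mul, h2, one_mul]

theorem LevelPair.exists_isIsoBy (p : LevelPair k J₀ n) {c : Ω} (hc : c ≠ 0) :
    ∃ p' : LevelPair k J₀ n, IsIsoBy c p p' ∧ p'.φ.Δ = p.φ.Δ / c ^ (q ^ 2 - 1) := by
  let φ : DrinfeldModule Ω := ⟨1, p.φ.g / c ^ (q - 1), p.φ.Δ / c ^ (q ^ 2 - 1),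
    div_ne_zero p.φ.Δ_ne_zero (pow_ne_zero _ hc)⟩
  have hJ : φ.J k = J₀ := by
    rw [← p.J_eq]
    simp only [DrinfeldModule.J, φ, div_pow, ← pow_mul, card_sub_one_mul_card_add_one]
    exact div_div_div_cancel_right₀ (pow_ne_zero _ hc) _ _
  have hu : ∀ y, c * p.φ.opT k y = φ.opT k (c * y) := by
    intro y
    simp only [opT_apply, p.gamma_T, φ, mul_pow]
    rw [← pow_mul c, ← pow_two, pow_card_sq_eq_mul, pow_card_eq_mul k c]
    have h1 := pow_ne_zero (q - 1) hc
    have h2 := pow_ne_zero (q ^ 2 - 1) hc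
    field_simp
  obtain ⟨p', hp', h⟩ := p.exists_transport φ rfl hJ
    ((LinearEquiv.smulOfNeZero Ω Ω c hc).restrictScalars k) hu
  exact ⟨p', ⟨hc, fun y => by rw [hp', hu], h⟩, by rw [hp']⟩

theorem LevelPair.exists_isConj (p : LevelPair k J₀ n) (σ : Ω ≃ₐ[k] Ω) (hσ : σ J₀ = J₀) :
    ∃ p' : LevelPair k J₀ n, IsConj σ.toRingEquiv p p' := by
  let φ : DrinfeldModule Ω := ⟨1, σ p.φ.g, σ p.φ.Δ, by simpa using p.φ.Δ_ne_zero⟩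
  have hJ : φ.J k = J₀ := by
    have := congrArg σ p.J_eq
    rw [hσ] at this
    simpa [DrinfeldModule.J, φ] using this
  obtain ⟨p', hp', h⟩ := p.exists_transport φ rfl hJ σ.toLinearEquiv
    (fun y => by simp [opT_apply, p.gamma_T, φ])
  exact ⟨p', by simp [hp', φ], by simp [hp', φ], h⟩

theorem LevelPair.IsConj.isIsoBy {σ : Ω ≃+* Ω} {c : Ω} {r r' : LevelPair k J₀ n}
    (h : IsConj σ p p') (h' : IsConj σ r r') (hc : IsIsoBy c p r) : IsIsoBy (σ c) p' r' := by
  refine ⟨by simpa using hc.1, fun y => ?_, fun y => ?_⟩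
  · obtain ⟨y, rfl⟩ := σ.surjective y
    rw [← map_opT h, ← map_mul, hc.2.1, map_opT h', map_mul]
  · obtain ⟨y, rfl⟩ := σ.surjective y
    rw [← h.2.2, hc.2.2, h'.2.2, map_mul]

theorem IsCoords.of_isIso (hx : IsCoords p x) (h : IsIso p p') : IsCoords p' x :=
  hx.elim fun r hr => ⟨r, h.symm.trans hr.1, hr.2⟩

theorem IsCoords.of_isConj (hx : IsCoords p x) (σ : Ω ≃ₐ[k] Ω) (hσ : σ J₀ = J₀)
    (h : IsConj σ.toRingEquiv p p') : IsCoords p' (fun j => σ (x j)) := by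
  obtain ⟨r, ⟨c, hc⟩, hr⟩ := hx
  obtain ⟨r', hr'⟩ := r.exists_isConj σ hσ
  exact ⟨r', ⟨_, h.isIsoBy hr' hc⟩, hr.of_isConj hr'⟩

/-- Two systems of coordinates of the same pair differ by a `(q² - 1)`-th root of unity. -/
theorem IsCoords.exists_eq_mul [Infinite Ω] (hx : IsCoords p x) (hx' : IsCoords p x') :
    ∃ c : Ω, c ^ (q ^ 2 - 1) = 1 ∧ ∀ j, j + 1 ≤ n → x' (j + 1) = c ^ q ^ j * x (j + 1) := by
  obtain ⟨r, ⟨c, hc⟩, hr⟩ := hx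
  obtain ⟨r', ⟨d, hd⟩, hr'⟩ := hx'
  have h1 := hc.symm.trans hd
  have h2 := hr.of_isIsoBy h1 hr'.normalized (x' := fun j => (d * c⁻¹) ^ q ^ (j - 1) * x j)
    fun j => rfl
  -- On the common pair r' the two generators of the T-torsion differ by a scalar in k, which is
  -- itself an automorphism of r' and can be absorbed into the isomorphism.
  obtain ⟨a, ha⟩ := exists_smul_of_opT_eq_zero h2.x_one_mem h2.x_one_ne_zero h2.x_one_torsion
    hr'.x_one_mem hr'.x_one_torsion
  have ha0 : a ≠ 0 := by
    rintro rfl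
    exact hr'.x_one_ne_zero (by rw [ha, zero_smul])
  have h3 := h1.trans (IsIsoBy.of_algebraMap ha0 r')
  refine ⟨_, h3.pow_eq_one hr.normalized hr'.normalized, fun j hj => ?_⟩
  have h4 := hr.of_isIsoBy h3 hr'.normalized
    (x' := fun j => (algebraMap k Ω a * (d * c⁻¹)) ^ q ^ (j - 1) * x j) fun j => rfl
  refine h4.eq_of_x_one_eq hr' ?_ (by simp) hj
  simp [ha, Algebra.smul_def, mul_assoc]

/-- The weight of (x_{i+1} x_{i+2})^(q-1) is (q^i + q^(i+1))(q-1) = q^i (q²-1). This is why Z_j is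
the right invariant. -/
theorem mul_pow_eq_of_pow_eq_one {c : Ω} (hc : c ^ (q ^ 2 - 1) = 1) (i : ℕ) (a b : Ω) :
    (c ^ q ^ i * a * (c ^ q ^ (i + 1) * b)) ^ (q - 1) = (a * b) ^ (q - 1) := by
  have : (c ^ q ^ i * c ^ q ^ (i + 1)) ^ (q - 1) = 1 := by
    rw [← pow_add, ← pow_mul, pow_succ, show (q ^ i + q ^ i * q) * (q - 1) =
      ((q - 1) * (q + 1)) * q ^ i by ring, card_sub_one_mul_card_add_one, pow_mul, hc, one_pow]
  calc _ = ((c ^ q ^ i * c ^ q ^ (i + 1)) * (a * b)) ^ (q - 1) := by ring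
    _ = _ := by rw [mul_pow, this, one_mul]

theorem IsCoords.x_one_pow_eq [Infinite Ω] (hn : 1 ≤ n) (hx : IsCoords p x)
    (hx' : IsCoords p x') : x' 1 ^ (q ^ 2 - 1) = x 1 ^ (q ^ 2 - 1) := by
  obtain ⟨c, hc, h⟩ := hx.exists_eq_mul hx'
  rw [h 0 hn, pow_zero, pow_one, mul_pow, hc, one_mul]

theorem IsCoords.z_pow_eq [Infinite Ω] (hx : IsCoords p x) (hx' : IsCoords p x') {j : ℕ}
    (h2 : 2 ≤ j) (hj : j ≤ n) :
    (x' (j - 1) * x' j) ^ (q - 1) = (x (j - 1) * x j) ^ (q - 1) := by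
  obtain ⟨c, hc, h⟩ := hx.exists_eq_mul hx'
  obtain ⟨j, rfl⟩ := Nat.exists_eq_add_of_le' h2
  rw [show j + 2 - 1 = j + 1 from rfl, h j (by omega), h (j + 1) hj, mul_pow_eq_of_pow_eq_one hc]

/-- This is Q_{x_j}(x_{j+1}) = x_j multiplied by x_j^q. -/
theorem IsNormalizedCoords.z_add_eq (hx : IsNormalizedCoords p x) {j : ℕ} (h1 : 1 ≤ j)
    (hj : j + 1 ≤ n) : x j * x (j + 1) * (1 + (x j * x (j + 1)) ^ (q - 1)) = x j ^ (q + 1) := by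
  have h := hx.dualP_eq h1 hj
  have h0 := hx.ne_zero h1 (by omega)
  rw [dualP, inv_mul_eq_div, div_add' _ _ _ (pow_ne_zero _ h0),
    div_eq_iff (pow_ne_zero _ h0)] at h
  have e1 := pow_card_eq_mul k (x j * x (j + 1))
  have e2 := pow_card_eq_mul k (x j)
  rw [mul_pow] at e1
  rw [pow_succ]
  linear_combination x j * h - e1 + (x j - x (j + 1) ^ q) * (-e2)

/-- The relations between the coordinates of a pair. -/
theorem IsNormalizedCoords.relations (hx : IsNormalizedCoords p x) {j : ℕ} (h1 : 1 ≤ j)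
    (hj : j + 1 ≤ n) : ∃ Z, Z = (x j * x (j + 1)) ^ (q - 1) ∧ Z ≠ 0 ∧ 1 + Z ≠ 0 ∧
      Z * (1 + Z) ^ (q - 1) = x j ^ (q ^ 2 - 1) ∧
      x (j + 1) ^ (q ^ 2 - 1) = Z ^ q / (1 + Z) ^ (q - 1) := by
  have h := hx.z_add_eq h1 hj
  have h0 := hx.ne_zero h1 (by omega)
  have h0' := hx.ne_zero (j := j + 1) (by omega) hj
  have hz : x j * x (j + 1) ≠ 0 := mul_ne_zero h0 h0'
  have hZ : 1 + (x j * x (j + 1)) ^ (q - 1) ≠ 0 := by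
    intro h'
    rw [h', mul_zero] at h
    exact pow_ne_zero _ h0 h.symm
  have hr : (x j * x (j + 1)) ^ (q - 1) * (1 + (x j * x (j + 1)) ^ (q - 1)) ^ (q - 1) =
      x j ^ (q ^ 2 - 1) := by
    rw [← mul_pow, h, ← pow_mul, mul_comm (q + 1), card_sub_one_mul_card_add_one]
  refine ⟨_, rfl, pow_ne_zero _ hz, hZ, hr, ?_⟩
  rw [eq_div_iff (pow_ne_zero _ hZ)]
  -- After multiplication by Z the right side is Z^(q+1) = z^(q²-1) = x_j^(q²-1) x_{j+1}^(q²-1), and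
  -- the relation `hr` supplies the first factor.
  apply mul_left_cancel₀ (pow_ne_zero (q - 1) hz)
  rw [← pow_succ', ← pow_mul _ (q - 1), card_sub_one_mul_card_add_one, mul_pow _ _ (q ^ 2 - 1),
    ← hr]
  ring

/-- Normalized pairs with the same invariants are isomorphic. -/
theorem IsCoords.isIso (hx : IsCoords p x) (hx' : IsCoords p' x')
    (h1 : x' 1 ^ (q ^ 2 - 1) = x 1 ^ (q ^ 2 - 1))
    (hZ : ∀ j, 2 ≤ j → j ≤ n → (x' (j - 1) * x' j) ^ (q - 1) = (x (j - 1) * x j) ^ (q - 1)) :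
    IsIso p p' := by
  obtain ⟨r, hpr, hr⟩ := hx
  obtain ⟨r', hpr', hr'⟩ := hx'
  refine hpr.trans (IsIso.trans ?_ hpr'.symm)
  -- Twisting r by this ratio, a (q²-1)-th root of unity, keeps Δ = -1 and makes the first
  -- coordinates equal.
  have hc0 : x' 1 / x 1 ≠ 0 := div_ne_zero hr'.x_one_ne_zero hr.x_one_ne_zero
  have hc : (x' 1 / x 1) ^ (q ^ 2 - 1) = 1 := by
    rw [div_pow, h1, div_self (pow_ne_zero _ hr.x_one_ne_zero)]
  obtain ⟨s, hrs, hs⟩ := r.exists_isIsoBy hc0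
  rw [hc, div_one, hr.normalized] at hs
  set c := x' 1 / x 1 with hcdef
  set y : ℕ → Ω := fun j => c ^ q ^ (j - 1) * x j with hy
  have hsc : IsNormalizedCoords s y := hr.of_isIsoBy hrs hs fun j => rfl
  have hy1 : x' 1 = y 1 := by
    simp [hy, hcdef, div_mul_cancel₀ _ hr.x_one_ne_zero]
  have hyj : ∀ j, 1 ≤ j → j ≤ n → x' j = y j := by
    intro j hj hjn
    induction j, hj using Nat.le_induction with
    | base => exact hy1
    | succ j hj ih =>
      have ih := ih (by omega)
      -- Once x_j and Z_{j+1} agree, x_{j+1} is recovered linearly from x_j x_{j+1} (1 + Z_{j+1}) =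
      -- x_j^(q+1).
      have hZj : (x' j * x' (j + 1)) ^ (q - 1) = (y j * y (j + 1)) ^ (q - 1) := by
        obtain ⟨i, rfl⟩ := Nat.exists_eq_add_of_le' hj
        have := hZ (i + 1 + 1) (by omega) hjn
        rw [Nat.add_sub_cancel] at this
        rw [this, ← mul_pow_eq_of_pow_eq_one hc i]
        rfl
      have e1 := hr'.z_add_eq hj hjn
      have e2 := hsc.z_add_eq hj hjn
      obtain ⟨Z, rfl, -, hZ1, -⟩ := hsc.relations hj hjn
      rw [hZj, ih, ← e2] at e1
      exact mul_left_cancel₀ (hsc.ne_zero hj (by omega)) (mul_right_cancel₀ hZ1 e1)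
  -- With equal coordinates the pairs coincide: x_1 determines g, and G is the kernel of the chain.
  refine IsIso.trans ⟨c, hrs⟩ ⟨1, one_ne_zero, fun y => ?_, fun y => ?_⟩
  · have hg : s.φ.g = r'.φ.g := by
      have e1 := hsc.g_mul_eq
      rw [← hy1, ← hr'.g_mul_eq] at e1
      exact mul_right_cancel₀ (pow_ne_zero _ hr'.x_one_ne_zero) e1
    rw [one_mul, one_mul, hsc.opT_eq, hr'.opT_eq, hg]
  · rw [one_mul, hsc.mem_pts_iff, hr'.mem_pts_iff,
      chainP_congr fun j h1 h2 => (hyj j h1 h2).symm]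

/-- For j ≤ m the point y_j is T^m-torsion and so already lies in T^(n-m) G. This gives the
compatibility of the coordinates with the tower. -/
theorem IsNormalizedCoords.degeneracy {m : ℕ} (hm : 1 ≤ m) (h : m ≤ n)
    (hx : IsNormalizedCoords p x) : IsNormalizedCoords (p.degeneracy h) x := by
  have key : ∀ y ∈ p.pts, (p.φ.opT k ^ m) y = 0 → y ∈ (p.degeneracy h).pts := fun y hy hy0 =>
    (mem_pts_degeneracy h p y).2 (exists_opT_pow_eq hy h hy0)
  refine ⟨hx.normalized, key _ hx.x_one_mem ?_, hx.x_one_ne_zero, hx.x_one_torsion,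
    fun j h1 hj => ?_⟩
  · obtain ⟨m, rfl⟩ := Nat.exists_eq_add_of_le' hm
    rw [pow_succ, Module.End.mul_apply, hx.x_one_torsion, map_zero]
  · obtain ⟨y, hy, hy1, hy2⟩ := hx.x_eq j h1 (hj.trans h)
    refine ⟨y, key y hy ?_, hy1, hy2⟩
    rw [show m = (m - j) + 1 + (j - 1) by omega, pow_add, Module.End.mul_apply, hy1, pow_succ,
      Module.End.mul_apply, hx.x_one_torsion, map_zero]

theorem IsCoords.degeneracy {m : ℕ} (hm : 1 ≤ m) (h : m ≤ n) (hx : IsCoords p x) :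
    IsCoords (p.degeneracy h) x :=
  hx.elim fun r hr => ⟨r.degeneracy h, hr.1.degeneracy h, hr.2.degeneracy hm h⟩

end Coordinates

/-! ### Existence of normalized pairs over a separably closed field. -/

section SeparablyClosed

variable {k Ω : Type*} [Field k] [Fintype k] [Field Ω] [Algebra k Ω] [IsSepClosed Ω]
variable {J₀ : Ω} {n : ℕ}

local notation "q" => Fintype.card k

open LevelPair

variable (k Ω) in
theorem natCast_card_eq_zero : (q : Ω) = 0 := by
  rw [← map_natCast (algebraMap k Ω), FiniteField.cast_card_eq_zero, map_zero]

/-- Every pair is isomorphic to a normalized pair. -/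
theorem exists_isIso_normalized (p : LevelPair k J₀ n) :
    ∃ p' : LevelPair k J₀ n, IsIso p p' ∧ p'.φ.Δ = -1 := by
  have hcast : ((q ^ 2 - 1 : ℕ) : Ω) = -1 := by
    rw [Nat.cast_sub (pow_pos Fintype.card_pos 2), Nat.cast_pow, natCast_card_eq_zero k Ω]
    simp
  have : NeZero ((q ^ 2 - 1 : ℕ) : Ω) := ⟨by rw [hcast]; simp⟩
  obtain ⟨c, hc⟩ := IsSepClosed.exists_pow_nat_eq (-p.φ.Δ) (q ^ 2 - 1)
  have hΔ := p.φ.Δ_ne_zero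
  have hq : q ^ 2 - 1 ≠ 0 := by
    have : 1 < q := Fintype.one_lt_card
    have : 1 < q ^ 2 := Nat.one_lt_pow two_ne_zero this
    omega
  have hc0 : c ≠ 0 := by
    rintro rfl
    rw [zero_pow hq] at hc
    exact hΔ (by simpa using hc.symm)
  obtain ⟨p', hp', h⟩ := p.exists_isIsoBy hc0
  exact ⟨p', ⟨c, hp'⟩, by rw [h, hc, div_neg, div_self hΔ]⟩

theorem exists_isCoords (hn : 1 ≤ n) (p : LevelPair k J₀ n) : ∃ x, IsCoords p x := by
  obtain ⟨p', h, hp'⟩ := exists_isIso_normalized p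
  obtain ⟨x, hx⟩ := exists_isNormalizedCoords hn p' hp'
  exact ⟨x, p', h, hx⟩

-- The characteristic divides q and the linear coefficient is γ(T) = 1, so the derivative is 1 and a
-- separable closure suffices for torsion and division points.
variable (k) in
theorem separable_additive (Δ g b : Ω) :
    (C Δ * X ^ q ^ 2 + C g * X ^ q + X + C b : Polynomial Ω).Separable := by
  have hd : derivative (C Δ * X ^ q ^ 2 + C g * X ^ q + X + C b : Polynomial Ω) = 1 := by
    simp [derivative_X_pow, natCast_card_eq_zero k Ω]
  rw [separable_def, hd]
  exact isCoprime_one_right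

variable (k) in
theorem degree_additive_ne_zero {Δ : Ω} (hΔ : Δ ≠ 0) (g b : Ω) :
    (C Δ * X ^ q ^ 2 + C g * X ^ q + X + C b : Polynomial Ω).degree ≠ 0 := by
  have hq : 1 < q := Fintype.one_lt_card
  have h2 : q < q ^ 2 := by nlinarith
  have h3 : 1 ≠ q ^ 2 := by omega
  have h4 : q ^ 2 ≠ 0 := by omega
  intro h
  have h0 := coeff_eq_zero_of_degree_lt (n := q ^ 2)
    (h.trans_lt (by exact_mod_cast Nat.pos_of_ne_zero h4))
  rw [coeff_add, coeff_add, coeff_add, coeff_C_mul, coeff_C_mul, coeff_X_pow, coeff_X_pow, coeff_X,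
    coeff_C, if_pos rfl, if_neg h2.ne', if_neg h3, if_neg h4] at h0
  exact hΔ (by simpa using h0)

theorem opT_surjective (φ : DrinfeldModule Ω) (h1 : φ.l₀ = 1) :
    Function.Surjective (φ.opT k) := by
  intro b
  obtain ⟨y, hy⟩ := IsSepClosed.exists_root _ (degree_additive_ne_zero k φ.Δ_ne_zero φ.g (-b))
    (separable_additive k φ.Δ φ.g (-b))
  refine ⟨y, ?_⟩
  simp only [IsRoot, eval_add, eval_mul, eval_C, eval_pow, eval_X] at hy
  rw [opT_apply, h1, ← pow_mul, ← pow_two]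
  linear_combination hy

theorem exists_opT_eq_zero (φ : DrinfeldModule Ω) (h1 : φ.l₀ = 1) :
    ∃ y ≠ 0, φ.opT k y = 0 := by
  have hq : 1 < q := Fintype.one_lt_card
  have h2 : q < q ^ 2 := by nlinarith
  have h3 : q ^ 2 - 1 ≠ 0 := by omega
  have h4 : q - 1 ≠ 0 := by omega
  have h5 : q ^ 2 - 1 ≠ q - 1 := by omega
  -- φ_T(X) divided by X: its constant term 1 ensures that the root found is nonzero.
  let h : Polynomial Ω := C φ.Δ * X ^ (q ^ 2 - 1) + C φ.g * X ^ (q - 1) + 1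
  have hX : X * h = C φ.Δ * X ^ q ^ 2 + C φ.g * X ^ q + X + C 0 := by
    have e1 : (X : Polynomial Ω) ^ q ^ 2 = X ^ (q ^ 2 - 1) * X := by
      rw [← pow_succ, Nat.sub_add_cancel (by omega)]
    have e2 : (X : Polynomial Ω) ^ q = X ^ (q - 1) * X := by
      rw [← pow_succ, Nat.sub_add_cancel (by omega)]
    rw [e1, e2, C_0]
    ring
  have hdeg : h.degree ≠ 0 := by
    intro hd
    have h0 := coeff_eq_zero_of_degree_lt (n := q ^ 2 - 1)
      (hd.trans_lt (by exact_mod_cast Nat.pos_of_ne_zero h3))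
    rw [coeff_add, coeff_add, coeff_C_mul, coeff_C_mul, coeff_X_pow, coeff_X_pow, coeff_one,
      if_pos rfl, if_neg h5, if_neg h3] at h0
    exact φ.Δ_ne_zero (by simpa using h0)
  obtain ⟨y, hy⟩ := IsSepClosed.exists_root h hdeg
    (Separable.of_mul_right (hX ▸ separable_additive k φ.Δ φ.g 0))
  refine ⟨y, ?_, ?_⟩
  · rintro rfl
    simp [h, zero_pow h3, zero_pow h4] at hy
  · have := congrArg (eval y) hX
    rw [eval_mul, hy.eq_zero, mul_zero] at this
    simp only [eval_add, eval_mul, eval_C, eval_pow, eval_X] at this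
    rw [opT_apply, h1, ← pow_mul, ← pow_two]
    linear_combination -this

/-- The annihilator of y is principal; its generator divides X^(m+1) but not X^m. -/
theorem aeval_eq_zero_iff_X_pow_dvd {f : Module.End k Ω} {y : Ω} {m : ℕ} (h0 : (f ^ m) y ≠ 0)
    (h1 : (f ^ (m + 1)) y = 0) (a : k[X]) : aeval f a y = 0 ↔ X ^ (m + 1) ∣ a := by
  constructor
  · intro ha
    let I : Ideal k[X] := LinearMap.ker (LinearMap.toSpanSingleton k[X] (Module.AEval' f)
      (Module.AEval'.of f y))
    have hI : ∀ b, b ∈ I ↔ aeval f b y = 0 := fun b => Iff.rfl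
    obtain ⟨d, hd⟩ := (inferInstance : I.IsPrincipal)
    have hd' : ∀ b, d ∣ b ↔ aeval f b y = 0 := fun b => by
      rw [← hI, hd]; exact Ideal.mem_span_singleton.symm
    obtain ⟨i, hi, hdi⟩ := (dvd_prime_pow prime_X _).1 ((hd' _).2 (by simpa using h1))
    rcases hi.lt_or_eq with hi | rfl
    · refine absurd ((hd' (X ^ m)).1 ?_) (by simpa using h0)
      exact hdi.dvd.trans (pow_dvd_pow _ (by omega))
    · exact hdi.symm.dvd.trans ((hd' a).2 ha)
  · rintro ⟨b, rfl⟩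
    rw [mul_comm, map_mul, Module.End.mul_apply]
    simp [h1]

/-- There are pairs of every positive level and with every nonzero invariant. -/
theorem exists_levelPair (hn : 1 ≤ n) (hJ : J₀ ≠ 0) : Nonempty (LevelPair k J₀ n) := by
  let φ : DrinfeldModule Ω := ⟨1, 1, J₀⁻¹, inv_ne_zero hJ⟩
  obtain ⟨y₀, hy₀, hy₀T⟩ := exists_opT_eq_zero (k := k) φ rfl
  have key : ∀ m, ∃ y, (φ.opT k ^ m) y = y₀ := by
    intro m
    have : Function.Surjective (φ.opT k ^ m) := by
      rw [Module.End.coe_pow]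
      exact (opT_surjective φ rfl).iterate m
    exact this y₀
  obtain ⟨m, rfl⟩ := Nat.exists_eq_add_of_le' hn
  obtain ⟨y, hy⟩ := key m
  obtain ⟨p, -⟩ := exists_of_generator φ rfl (by simp [DrinfeldModule.J, φ] : φ.J k = J₀) y
    (aeval_eq_zero_iff_X_pow_dvd (m := m) (by rwa [hy])
      (by rw [pow_succ', Module.End.mul_apply, hy, hy₀T]))
  exact ⟨p⟩

end SeparablyClosed

/-! ### Valuations and ramification. -/

section Valuations

variable {L Ω : Type*} [Field L] [Field Ω] [Algebra L Ω]

theorem exists_valuation_sum_eq {Γ : Type*} [LinearOrderedCommGroupWithZero Γ] (v : Valuation Ω Γ)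
    {s : Finset ℕ} (hs : s.Nonempty) {f : ℕ → Ω}
    (hinj : ∀ i ∈ s, ∀ j ∈ s, v (f i) = v (f j) → i = j) :
    ∃ i ∈ s, v (∑ i ∈ s, f i) = v (f i) := by
  obtain ⟨i, hi, hmax⟩ := s.exists_max_image (fun i => v (f i)) hs
  refine ⟨i, hi, v.map_sum_eq_of_lt hi (fun j hj => ?_)⟩
  rw [Finset.mem_sdiff, Finset.mem_singleton] at hj
  exact lt_of_le_of_ne (hmax j hj.1) fun h => hj.2 (hinj j hj.1 i hi h)

/-- There is a valuation, trivial on `L`, at which a given transcendental element is small. -/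
theorem exists_valuationSubring {t : Ω} (ht : Transcendental L t) :
    ∃ V : ValuationSubring Ω, (∀ a : L, algebraMap L Ω a ∈ V) ∧ V.valuation t < 1 := by
  let e := AlgEquiv.ofInjective (aeval t : L[X] →ₐ[L] Ω) (transcendental_iff_injective.1 ht)
  let A : Subring Ω := (aeval t : L[X] →ₐ[L] Ω).range.toSubring
  -- Evaluation of L[t] at t = 0; a valuation ring dominating the localization at its kernel makes t
  -- a non-unit.
  let ψ : A →+* L := (aeval (0 : L)).toRingHom.comp e.symm.toRingEquiv.toRingHom
  have : (RingHom.ker ψ).IsPrime := RingHom.ker_isPrime ψ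
  let B := LocalSubring.ofPrime A (RingHom.ker ψ)
  obtain ⟨V, hAV, hloc⟩ := B.exists_le_valuationSubring
  have hAB : A ≤ B.toSubring := LocalSubring.le_ofPrime _ _
  have htA : t ∈ A := ⟨X, by simp⟩
  refine ⟨V, fun a => hAV (hAB ⟨C a, by simp⟩), ?_⟩
  let tB : B.toSubring := ⟨t, hAB htA⟩
  have htψ : (⟨t, htA⟩ : A) ∈ RingHom.ker ψ := by
    have : (⟨t, htA⟩ : A) = e X := Subtype.ext (by simp [e])
    rw [this, RingHom.mem_ker]
    simp [ψ]
  have hnu : ¬ IsUnit tB := by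
    have := (IsLocalization.AtPrime.isUnit_to_map_iff B.toSubring (RingHom.ker ψ) ⟨t, htA⟩).not.2
      (not_not.2 htψ)
    exact this
  have hnu' : ¬ IsUnit (⟨t, hAV (hAB htA)⟩ : V) := fun h => hnu (hloc.map_nonunit tB h)
  exact (V.valuation_lt_one_iff ⟨t, hAV (hAB htA)⟩).1 hnu'

variable {Γ : Type*} [LinearOrderedCommGroupWithZero Γ] {v : Valuation Ω Γ} {t : Ω}

theorem exists_valuation_aeval_eq (hL : ∀ a : L, a ≠ 0 → v (algebraMap L Ω a) = 1) (ht0 : t ≠ 0)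
    (ht : v t < 1) {f : L[X]} (hf : f ≠ 0) : ∃ m : ℕ, v (aeval t f) = v t ^ m := by
  have hv0 : 0 < v t := zero_lt_iff.2 ((v.ne_zero_iff).2 ht0)
  have key : ∀ i ∈ f.support, v (algebraMap L Ω (f.coeff i) * t ^ i) = v t ^ i := by
    intro i hi
    rw [map_mul, hL _ (mem_support_iff.1 hi), one_mul, map_pow]
  obtain ⟨i, hi, h⟩ := exists_valuation_sum_eq v (nonempty_support_iff.2 hf)
    (f := fun i => algebraMap L Ω (f.coeff i) * t ^ i)
    (fun i hi j hj h => by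
      rw [key i hi, key j hj] at h
      exact pow_right_injective₀ hv0 ht.ne h)
  refine ⟨i, ?_⟩
  rw [← key i hi, ← h, aeval_eq_sum_range' (Nat.lt_succ_self _), Finset.sum_subset
    (supp_subset_range (Nat.lt_succ_self f.natDegree)) (fun i _ hi => by
      rw [notMem_support_iff.1 hi, map_zero, zero_mul])]
  simp only [Algebra.smul_def]

theorem exists_valuation_eq_zpow (hL : ∀ a : L, a ≠ 0 → v (algebraMap L Ω a) = 1) (ht0 : t ≠ 0)
    (ht : v t < 1) {y : Ω} (hy : y ∈ IntermediateField.adjoin L {t}) (hy0 : y ≠ 0) :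
    ∃ m : ℤ, v y = v t ^ m := by
  have hv0 : v t ≠ 0 := (v.ne_zero_iff).2 ht0
  obtain ⟨r, s, rfl⟩ := (IntermediateField.mem_adjoin_simple_iff L y).1 hy
  obtain ⟨a, ha⟩ := exists_valuation_aeval_eq hL ht0 ht (f := r) (by rintro rfl; simp at hy0)
  obtain ⟨b, hb⟩ := exists_valuation_aeval_eq hL ht0 ht (f := s) (by rintro rfl; simp at hy0)
  exact ⟨a - b, by rw [map_div₀, ha, hb, zpow_sub₀ hv0, zpow_natCast, zpow_natCast]⟩

/-- Ramification bounds the degree from below. -/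
theorem le_natDegree_of_aeval_eq_zero {F : IntermediateField L Ω} {U : Ω} {N : ℕ}
    (hF : ∀ y ∈ F, y ≠ 0 → ∃ m : ℤ, v y = v t ^ m) (ht0 : t ≠ 0) (ht : v t < 1)
    (hU : v U ^ N = v t) {f : Polynomial F} (hf : f ≠ 0) (hfU : aeval U f = 0) :
    N ≤ f.natDegree := by
  by_contra! hN
  have hv0 : v t ≠ 0 := (v.ne_zero_iff).2 ht0
  have hN0 : N ≠ 0 := by omega
  have hU0 : 0 < v U := by
    rw [zero_lt_iff]
    intro h
    rw [h, zero_pow hN0] at hU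
    exact hv0 hU.symm
  have hU1 : v U ≠ 1 := by
    intro h
    rw [h, one_pow] at hU
    exact ht.ne hU.symm
  have key : ∀ i ∈ f.support, ∃ m : ℤ, v (algebraMap F Ω (f.coeff i) * U ^ i) =
      v U ^ (N * m + i : ℤ) := by
    intro i hi
    obtain ⟨m, hm⟩ := hF (f.coeff i) (f.coeff i).2 (by
      simpa using mem_support_iff.1 hi)
    refine ⟨m, ?_⟩
    rw [map_mul, map_pow, zpow_add₀ hU0.ne', zpow_mul, zpow_natCast, zpow_natCast, hU, ← hm]
    rfl
  obtain ⟨i, hi, h⟩ := exists_valuation_sum_eq v (nonempty_support_iff.2 hf)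
    (f := fun i => algebraMap F Ω (f.coeff i) * U ^ i)
    (fun i hi j hj h => by
      obtain ⟨a, ha⟩ := key i hi
      obtain ⟨b, hb⟩ := key j hj
      rw [ha, hb] at h
      have h := zpow_right_injective₀ hU0 hU1 h
      have hi' := (le_natDegree_of_mem_supp i hi).trans_lt hN
      have hj' := (le_natDegree_of_mem_supp j hj).trans_lt hN
      -- Terms of different degree i < N have values v(U)^(Nm + i) with different exponents mod N,
      -- so one term dominates and the sum cannot vanish.
      have := congrArg (· % (N : ℤ)) h
      simp only [Int.mul_add_emod_self_left] at this
      rw [Int.emod_eq_of_lt (by omega) (by omega), Int.emod_eq_of_lt (by omega) (by omega)] at this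
      exact_mod_cast this)
  obtain ⟨m, hm⟩ := key i hi
  rw [hm] at h
  rw [aeval_eq_sum_range' (Nat.lt_succ_self _), ← Finset.sum_subset
    (supp_subset_range (Nat.lt_succ_self f.natDegree)) (fun i _ hi => by
      rw [notMem_support_iff.1 hi, zero_smul])] at hfU
  simp only [Algebra.smul_def] at hfU
  rw [hfU, map_zero] at h
  exact zpow_ne_zero _ hU0.ne' h.symm

/-- If v(U) ≥ 1, the right side would have value at most v(t) v(U)^(q-1) < v(U)^q. So v(U) < 1, and
the factors 1 + t and 1 + U are units. -/
theorem valuation_eq_of_relation {q r : ℕ} (hq : 1 ≤ q) {U : Ω} (ht : v t < 1)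
    (h : U ^ q = t * (1 + t) ^ r * (1 + U) ^ (q - 1)) : v U < 1 ∧ v U ^ q = v t := by
  have hv := congrArg v h
  rw [map_mul, map_mul, map_pow, map_pow, map_pow, v.map_one_add_of_lt ht, one_pow,
    mul_one] at hv
  have hU : v U < 1 := by
    by_contra! hU
    have h1 : v (1 + U) ≤ v U := (v.map_add _ _).trans (by simp [hU])
    have h2 : v U ^ q ≤ v t * v U ^ (q - 1) := hv.trans_le (by gcongr)
    have hU0 : 0 < v U ^ (q - 1) := pow_pos (zero_lt_one.trans_le hU) _
    rw [← Nat.sub_add_cancel hq, pow_succ', Nat.add_sub_cancel] at h2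
    exact (ht.trans_le hU).not_ge (le_of_mul_le_mul_right h2 hU0)
  rw [v.map_one_add_of_lt hU, one_pow, mul_one] at hv
  exact ⟨hU, hv⟩

end Valuations

/-! ### Towers totally ramified at one place. -/

section Tower

open IntermediateField

variable {L Ω : Type*} [Field L] [Field Ω] [Algebra L Ω]

theorem monic_relation {R : Type*} [CommRing R] [Nontrivial R] {q : ℕ} (hq : 1 ≤ q) (c : R) :
    (X ^ q - C c * (1 + X) ^ (q - 1) : R[X]).Monic ∧
      (X ^ q - C c * (1 + X) ^ (q - 1) : R[X]).natDegree = q := by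
  have h : (C c * (1 + X) ^ (q - 1) : R[X]).degree < q := by
    refine lt_of_le_of_lt (degree_le_of_natDegree_le (n := q - 1) ?_)
      (by exact_mod_cast Nat.sub_lt hq one_pos)
    compute_degree
  refine ⟨monic_X_pow_sub h, ?_⟩
  rw [natDegree_eq_of_degree_eq (degree_sub_eq_left_of_degree_lt (by rwa [degree_X_pow])),
    natDegree_X_pow]

theorem relfinrank_adjoin_insert {S : Set Ω} {a : Ω} (ha : IsIntegral (adjoin L S) a) :
    relfinrank (adjoin L S) (adjoin L (insert a S)) = (minpoly (adjoin L S) a).natDegree := by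
  have hle : adjoin L S ≤ adjoin L (insert a S) := adjoin.mono _ _ _ (Set.subset_insert _ _)
  rw [relfinrank_eq_finrank_of_le hle, ← adjoin.finrank ha, extendScalars_adjoin]
  have : adjoin (adjoin L S) (insert a S) = adjoin (adjoin L S) {a} := by
    refine le_antisymm (adjoin_le_iff.2 ?_) (adjoin.mono _ _ _ (by simp))
    rintro y (rfl | hy)
    · exact mem_adjoin_simple_self _ _
    · exact IntermediateField.algebraMap_mem _ (⟨y, subset_adjoin _ _ hy⟩ : adjoin L S)
  rw [this]

theorem le_relfinrank {F E : IntermediateField L Ω} (h : F ≤ E) (hpos : 0 < relfinrank F E) {U : Ω}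
    (hU : U ∈ E) {N : ℕ}
    (hN : ∀ f : Polynomial F, f ≠ 0 → aeval U f = 0 → N ≤ f.natDegree) : N ≤ relfinrank F E := by
  rw [relfinrank_eq_finrank_of_le h] at hpos ⊢
  have : FiniteDimensional F (extendScalars h) := FiniteDimensional.of_finrank_pos hpos
  have : Module.Free F (extendScalars h) := Module.Free.of_divisionRing F (extendScalars h)
  let y : extendScalars h := ⟨U, hU⟩
  have hy : IsIntegral F y := .of_finite F y
  refine (hN (minpoly F y) (minpoly.ne_zero hy) ?_).trans (minpoly.natDegree_le (A := F) y)
  have := congrArg (algebraMap (extendScalars h) Ω) (minpoly.aeval F y)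
  rwa [← aeval_algebraMap_apply, map_zero] at this

variable {q m : ℕ} {r : ℕ → ℕ} {u : ℕ → Ω}

theorem image_Iic_succ (u : ℕ → Ω) (i : ℕ) :
    u '' Set.Iic (i + 1) = insert (u (i + 1)) (u '' Set.Iic i) := by
  rw [← Set.image_insert_eq]
  congr 1
  ext j
  simp only [Set.mem_Iic, Set.mem_insert_iff]
  omega

theorem exists_monic_aeval_eq_zero (hq : 1 ≤ q) {F : IntermediateField L Ω} {t U : Ω} {r : ℕ}
    (ht : t ∈ F) (h : U ^ q = t * (1 + t) ^ r * (1 + U) ^ (q - 1)) :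
    ∃ f : Polynomial F, f.Monic ∧ f.natDegree = q ∧ aeval U f = 0 := by
  let c : F := ⟨t, ht⟩ * (1 + ⟨t, ht⟩) ^ r
  refine ⟨_, (monic_relation hq c).1, (monic_relation hq c).2, ?_⟩
  have hc : algebraMap F Ω c = t * (1 + t) ^ r := rfl
  simp [hc, h]

/-- In a tower given by the relations `U^q = t (1 + t)^r (1 + U)^(q-1)`, each step is totally
ramified at the place where all generators are small, and hence of degree `q`. -/
theorem natDegree_minpoly_tower (hq : 1 ≤ q) (h0 : Transcendental L (u 0))
    (h : ∀ i < m, u (i + 1) ^ q = u i * (1 + u i) ^ r i * (1 + u (i + 1)) ^ (q - 1)) {i : ℕ}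
    (hi : i < m) : relfinrank (adjoin L (u '' Set.Iic i)) (adjoin L (u '' Set.Iic (i + 1))) = q ∧
      (minpoly (adjoin L (u '' Set.Iic i)) (u (i + 1))).natDegree = q := by
  have hmem : ∀ i, u i ∈ adjoin L (u '' Set.Iic i) := fun i =>
    subset_adjoin _ _ ⟨i, Set.self_mem_Iic, rfl⟩
  have hmono : Monotone fun i => adjoin L (u '' Set.Iic i) := fun i j hij =>
    adjoin.mono _ _ _ (Set.image_mono (Set.Iic_subset_Iic.2 hij))
  have hstep : ∀ i < m, ∃ d, 0 < d ∧ d ≤ q ∧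
      relfinrank (adjoin L (u '' Set.Iic i)) (adjoin L (u '' Set.Iic (i + 1))) = d ∧
      (minpoly (adjoin L (u '' Set.Iic i)) (u (i + 1))).natDegree = d := by
    intro i hi
    obtain ⟨f, hf, hfd, hfu⟩ := exists_monic_aeval_eq_zero hq (hmem i) (h i hi)
    have hint : IsIntegral (adjoin L (u '' Set.Iic i)) (u (i + 1)) := ⟨f, hf, hfu⟩
    refine ⟨_, minpoly.natDegree_pos hint, ?_, ?_, rfl⟩
    · rw [← hfd]
      exact natDegree_le_natDegree (minpoly.min _ _ hf hfu)
    · rw [image_Iic_succ, relfinrank_adjoin_insert hint]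
  have hmul : ∀ i, relfinrank (adjoin L (u '' Set.Iic 0)) (adjoin L (u '' Set.Iic (i + 1))) =
      relfinrank (adjoin L (u '' Set.Iic 0)) (adjoin L (u '' Set.Iic i)) *
      relfinrank (adjoin L (u '' Set.Iic i)) (adjoin L (u '' Set.Iic (i + 1))) := fun i =>
    (relfinrank_mul_relfinrank (hmono (Nat.zero_le i)) (hmono i.le_succ)).symm
  have hpos : ∀ i ≤ m, 0 < relfinrank (adjoin L (u '' Set.Iic 0)) (adjoin L (u '' Set.Iic i)) := by
    intro i
    induction i with
    | zero => simp
    | succ i ih =>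
      intro hi
      obtain ⟨d, hd, -, hd', -⟩ := hstep i (by omega)
      rw [hmul, hd']
      exact Nat.mul_pos (ih (by omega)) hd
  obtain ⟨V, hV, hV0⟩ := exists_valuationSubring h0
  have hu0 : u 0 ≠ 0 := by
    intro h
    rw [h] at h0
    exact h0 isAlgebraic_zero
  have hL : ∀ a : L, a ≠ 0 → V.valuation (algebraMap L Ω a) = 1 := by
    intro a ha
    apply le_antisymm ((V.valuation_le_one_iff _).2 (hV a))
    have := (V.valuation_le_one_iff _).2 (hV a⁻¹)
    rw [map_inv₀, map_inv₀] at this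
    exact (inv_le_one₀ (zero_lt_iff.2 ((Valuation.ne_zero_iff _).2 (by simpa using ha)))).1 this
  have hval : ∀ i ≤ m, u i ≠ 0 ∧ V.valuation (u i) < 1 ∧
      V.valuation (u i) ^ q ^ i = V.valuation (u 0) := by
    intro i
    induction i with
    | zero => exact fun _ => ⟨hu0, hV0, by simp⟩
    | succ i ih =>
      intro hi
      obtain ⟨h1, h2, h3⟩ := ih (by omega)
      obtain ⟨h4, h5⟩ := valuation_eq_of_relation hq h2 (h i (by omega))
      refine ⟨?_, h4, by rw [pow_succ', pow_mul, h5, h3]⟩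
      rw [← Valuation.ne_zero_iff V.valuation]
      intro h6
      rw [h6, zero_pow (by omega)] at h5
      exact (Valuation.ne_zero_iff _).2 h1 h5.symm
  have hIic : u '' Set.Iic 0 = {u 0} := by
    rw [← bot_eq_zero, Set.Iic_bot, Set.image_singleton]
  -- Since v(u_i)^(q^i) = v(u_0), ramification over L(u_0) bounds the degree below by q^i. The
  -- defining equations bound it above by q^i, so every single step has degree exactly q.
  have hlow : ∀ i ≤ m,
      q ^ i ≤ relfinrank (adjoin L (u '' Set.Iic 0)) (adjoin L (u '' Set.Iic i)) := by
    intro i hi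
    refine le_relfinrank (hmono (Nat.zero_le i)) (hpos i hi) (hmem i) fun f hf hfu => ?_
    refine le_natDegree_of_aeval_eq_zero (v := V.valuation) (t := u 0) (U := u i) ?_ hu0 hV0
      (hval i hi).2.2 hf hfu
    intro y hy hy0
    replace hy : y ∈ adjoin L (u '' Set.Iic 0) := hy
    rw [hIic] at hy
    exact exists_valuation_eq_zpow hL hu0 hV0 hy hy0
  have hupp : ∀ i ≤ m,
      relfinrank (adjoin L (u '' Set.Iic 0)) (adjoin L (u '' Set.Iic i)) ≤ q ^ i := by
    intro i
    induction i with
    | zero => simp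
    | succ i ih =>
      intro hi
      obtain ⟨d, -, hd, hd', -⟩ := hstep i (by omega)
      rw [hmul, hd', pow_succ]
      exact Nat.mul_le_mul (ih (by omega)) hd
  obtain ⟨d, -, -, hd', hd''⟩ := hstep i hi
  have h1 := le_antisymm (hupp i hi.le) (hlow i hi.le)
  have h2 := le_antisymm (hupp (i + 1) hi) (hlow (i + 1) hi)
  rw [hmul, h1, hd', pow_succ] at h2
  have h3 := Nat.eq_of_mul_eq_mul_left (pow_pos hq i) h2
  exact ⟨hd'.trans h3, hd''.trans h3⟩

end Tower

/-! ### The ideal of relations. -/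

section Kernel

open IntermediateField

variable {L Ω : Type*} [Field L] [Field Ω] [Algebra L Ω] {q : ℕ}

/-- Induction along the tower. Modulo the monic relation, an element is a polynomial of degree < q
in the last generator. If its image vanishes, so do the images of its coefficients, because the
minimal polynomial in Ω has degree q; by induction the coefficients are zero. -/
theorem injOn_adjoin_of_relations {A : Type*} [CommRing A] [Algebra L A] (ψ : A →ₐ[L] Ω)
    (hq : 1 ≤ q) {m : ℕ} {r : ℕ → ℕ} {v : ℕ → A} (h0 : Transcendental L (ψ (v 0)))
    (h : ∀ i < m, v (i + 1) ^ q = v i * (1 + v i) ^ r i * (1 + v (i + 1)) ^ (q - 1)) {i : ℕ}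
    (hi : i ≤ m) {a : A} (ha : a ∈ Algebra.adjoin L (v '' Set.Iic i)) (ha0 : ψ a = 0) :
    a = 0 := by
  induction i generalizing a with
  | zero =>
    rw [← bot_eq_zero, Set.Iic_bot, Set.image_singleton, bot_eq_zero,
      Algebra.adjoin_singleton_eq_range_aeval] at ha
    obtain ⟨f, rfl⟩ := ha
    have : f = 0 := by
      by_contra hf
      refine h0 ⟨f, hf, ?_⟩
      rwa [aeval_algHom_apply]
    simp [this]
  | succ i ih =>
    have ih := fun {a} => ih (a := a) (by omega)
    set B := Algebra.adjoin L (v '' Set.Iic i) with hB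
    have : Nontrivial A := ⟨⟨0, 1, fun h01 => by simpa using congrArg ψ h01⟩⟩
    have hvB : v i ∈ B := Algebra.subset_adjoin ⟨i, Set.self_mem_Iic, rfl⟩
    have haB : a ∈ Algebra.adjoin B {v (i + 1)} := by
      have hI : v '' Set.Iic (i + 1) = v '' Set.Iic i ∪ {v (i + 1)} := by
        rw [← Set.image_singleton, ← Set.image_union]
        congr 1
        ext j
        simp only [Set.mem_Iic, Set.mem_union, Set.mem_singleton_iff]
        omega
      rw [hI, Algebra.adjoin_union_eq_adjoin_adjoin] at ha
      exact ha
    rw [Algebra.adjoin_singleton_eq_range_aeval] at haB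
    obtain ⟨f, rfl⟩ := haB
    let c : B := ⟨v i, hvB⟩ * (1 + ⟨v i, hvB⟩) ^ r i
    have hc : algebraMap B A c = v i * (1 + v i) ^ r i := rfl
    let g : Polynomial B := X ^ q - C c * (1 + X) ^ (q - 1)
    obtain ⟨hg, hgd⟩ : g.Monic ∧ g.natDegree = q := monic_relation hq c
    have hgv : aeval (v (i + 1)) g = 0 := by simp [g, hc, h i hi]
    have hff : aeval (v (i + 1)) (f %ₘ g) = aeval (v (i + 1)) f :=
      aeval_modByMonic_eq_self_of_root hgv
    set u : ℕ → Ω := fun i => ψ (v i) with hu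
    let E := adjoin L (u '' Set.Iic i)
    have hψB : ∀ b : B, ψ b ∈ E := by
      intro b
      have h1 : B.map ψ ≤ E.toSubalgebra := by
        rw [hB, AlgHom.map_adjoin]
        refine Algebra.adjoin_le ?_
        rintro _ ⟨_, ⟨j, hj, rfl⟩, rfl⟩
        exact subset_adjoin _ _ ⟨j, hj, rfl⟩
      exact h1 ⟨b, b.2, rfl⟩
    let θ : B →+* E := (ψ.toRingHom.comp B.subtype).codRestrict E.toSubfield hψB
    have hdeg : (minpoly E (u (i + 1))).natDegree = q := by
      refine (natDegree_minpoly_tower hq h0 (u := u) (r := r) (m := m) (fun j hj => ?_) hi).2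
      simpa using congrArg ψ (h j hj)
    have hzero : (f %ₘ g).map θ = 0 := by
      by_contra hne
      have hroot : aeval (u (i + 1)) ((f %ₘ g).map θ) = 0 := by
        have h1 : ψ.toRingHom (aeval (v (i + 1)) (f %ₘ g)) = 0 := by
          rw [hff]
          exact ha0
        rw [aeval_def, hom_eval₂] at h1
        rw [aeval_def, eval₂_map]
        exact h1
      have h1 := natDegree_le_natDegree (minpoly.degree_le_of_ne_zero E (u (i + 1)) hne hroot)
      have h2 : (f %ₘ g).natDegree < q := by
        rw [← hgd]
        exact natDegree_modByMonic_lt _ hg (by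
          intro h1
          rw [h1, natDegree_one] at hgd
          omega)
      have h3 := natDegree_map_le (f := θ) (p := f %ₘ g)
      omega
    have hcoef : f %ₘ g = 0 := by
      ext j
      refine congrArg Subtype.val (a₁ := (f %ₘ g).coeff j) (a₂ := 0) ?_
      refine Subtype.ext (ih ((f %ₘ g).coeff j).2 ?_)
      have := congrArg (fun F : Polynomial E => (F.coeff j : Ω)) hzero
      rw [coeff_map] at this
      exact this
    change aeval (v (i + 1)) f = 0
    rw [← hff, hcoef, map_zero]

/-- The cleared relations generate the ideal of all relations. -/
theorem ker_aeval_eq_span_relations (hq : 1 ≤ q) {n : ℕ} (hn : 1 ≤ n) {ξ : ℕ → Ω}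
    (htr : Transcendental L (ξ n)) (h2 : 2 ≤ n → ξ 2 * (1 + ξ 2) ^ (q - 1) = ξ 1)
    (h : ∀ j, 2 ≤ j → j + 1 ≤ n →
      ξ (j + 1) * (1 + ξ (j + 1)) ^ (q - 1) * (1 + ξ j) ^ (q - 1) = ξ j ^ q) :
    RingHom.ker (MvPolynomial.aeval (fun j : Set.Icc 1 n => ξ j) :
      MvPolynomial (Set.Icc 1 n) L →ₐ[L] Ω) = Ideal.span (relations q L n) := by
  set I := Ideal.span (relations q L n) with hI
  have hle : I ≤ RingHom.ker (MvPolynomial.aeval (fun j : Set.Icc 1 n => ξ j) :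
      MvPolynomial (Set.Icc 1 n) L →ₐ[L] Ω) := by
    rw [hI, Ideal.span_le]
    rintro _ (⟨⟨a, ha⟩, ⟨b, hb⟩, rfl, rfl, rfl⟩ | ⟨⟨a, ha⟩, ⟨b, hb⟩, ha2, hab, rfl⟩)
    · simp [RingHom.mem_ker, h2 hb.2]
    · simp only at ha2 hab
      subst hab
      simp [RingHom.mem_ker, h a ha2 hb.2]
  refine le_antisymm (fun f hf => ?_) hle
  let ψ : MvPolynomial (Set.Icc 1 n) L ⧸ I →ₐ[L] Ω := Ideal.Quotient.liftₐ I
    (MvPolynomial.aeval (fun j : Set.Icc 1 n => ξ j)) fun a ha => hle ha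
  let y : ℕ → MvPolynomial (Set.Icc 1 n) L ⧸ I := fun j =>
    if hj : j ∈ Set.Icc 1 n then Ideal.Quotient.mkₐ L I (MvPolynomial.X ⟨j, hj⟩) else 0
  have hy : ∀ j (hj : j ∈ Set.Icc 1 n),
      y j = Ideal.Quotient.mkₐ L I (MvPolynomial.X ⟨j, hj⟩) := fun j hj => dif_pos hj
  have hψ : ∀ g, ψ (Ideal.Quotient.mkₐ L I g) =
      MvPolynomial.aeval (fun j : Set.Icc 1 n => ξ j) g := fun g => rfl
  have hmk : ∀ g ∈ relations q L n, Ideal.Quotient.mkₐ L I g = 0 := fun g hg =>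
    Ideal.Quotient.eq_zero_iff_mem.2 (Ideal.subset_span hg)
  have hrel : ∀ j, 2 ≤ j → j + 1 ≤ n →
      y j ^ q = y (j + 1) * (1 + y (j + 1)) ^ (q - 1) * (1 + y j) ^ (q - 1) := by
    intro j hj hjn
    have := hmk _ (Or.inr ⟨⟨j, by omega, by omega⟩, ⟨j + 1, by omega, by omega⟩, hj, rfl, rfl⟩)
    rw [hy j ⟨by omega, by omega⟩, hy (j + 1) ⟨by omega, by omega⟩]
    simp only [map_sub, map_mul, map_pow, map_add, map_one] at this
    exact (sub_eq_zero.1 this).symm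
  -- The tower is indexed downwards from X_n: the relations are monic in X_j over X_{j+1}, whereas
  -- in X_{j+1} the leading coefficient (1 + X_j)^(q-1) need not be a unit. The variable X_1 is
  -- eliminated by the first relation.
  set S := Algebra.adjoin L ((fun i => y (n - i)) '' Set.Iic (n - 2)) with hS
  have hyS2 : ∀ j, 2 ≤ j → j ≤ n → y j ∈ S := fun j hj hjn =>
    Algebra.subset_adjoin ⟨n - j, by simp only [Set.mem_Iic]; omega, by
      simp only [Nat.sub_sub_self hjn]⟩
  have hyS : ∀ j, 1 ≤ j → j ≤ n → y j ∈ S := by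
    intro j hj hjn
    rcases Nat.lt_or_ge 1 j with h1 | h1
    · exact hyS2 j h1 hjn
    obtain rfl : j = 1 := by omega
    rcases Nat.lt_or_ge 1 n with h1 | h1
    · have m1 : 1 ∈ Set.Icc 1 n := ⟨by omega, by omega⟩
      have m2 : 2 ∈ Set.Icc 1 n := ⟨by omega, by omega⟩
      have := hmk _ (Or.inl ⟨⟨1, m1⟩, ⟨2, m2⟩, rfl, rfl, rfl⟩)
      simp only [map_sub, map_mul, map_pow, map_add, map_one] at this
      rw [← hy, ← hy, sub_eq_zero] at this
      rw [← this]
      have h2 := hyS2 2 le_rfl h1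
      exact S.mul_mem h2 (S.pow_mem (S.add_mem S.one_mem h2) _)
    · obtain rfl : n = 1 := by omega
      exact Algebra.subset_adjoin ⟨0, by simp, rfl⟩
  have hmem : ∀ g, Ideal.Quotient.mkₐ L I g ∈ S := by
    intro g
    induction g using MvPolynomial.induction_on with
    | C a => exact S.algebraMap_mem a
    | add a b ha hb => rw [map_add]; exact S.add_mem ha hb
    | mul_X a j ha =>
      rw [map_mul, ← hy j.1 j.2]
      exact S.mul_mem ha (hyS j.1 j.2.1 j.2.2)
  refine Ideal.Quotient.eq_zero_iff_mem.1 ?_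
  refine injOn_adjoin_of_relations ψ hq (m := n - 2) (r := fun _ => q - 1)
    (v := fun i => y (n - i)) ?_ (fun i hi => ?_) le_rfl (hmem f) ?_
  · simp only [Nat.sub_zero]
    rwa [hy n ⟨hn, le_rfl⟩, hψ, MvPolynomial.aeval_X]
  · have := hrel (n - (i + 1)) (by omega) (by omega)
    rwa [show n - (i + 1) + 1 = n - i by omega] at this
  · exact hf

/-- Algebraicity over `L` is inherited along the relations. -/
theorem isAlgebraic_of_relation (hq : 1 ≤ q) {t U : Ω} {r : ℕ} (ht : IsAlgebraic L t)
    (h : U ^ q = t * (1 + t) ^ r * (1 + U) ^ (q - 1)) : IsAlgebraic L U := by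
  obtain ⟨f, hf, -, hfU⟩ := exists_monic_aeval_eq_zero hq
    (F := algebraicClosure L Ω) (mem_algebraicClosure_iff.2 ht) h
  have : IsIntegral (algebraicClosure L Ω) U := ⟨f, hf, hfU⟩
  exact (isIntegral_trans (R := L) U this).isAlgebraic

theorem relfinrank_adjoin_pair (hq : 1 ≤ q) {a b : Ω} {r : ℕ} (ha : Transcendental L a)
    (h : b ^ q = a * (1 + a) ^ r * (1 + b) ^ (q - 1)) : relfinrank L⟮a⟯ L⟮a, b⟯ = q := by
  have := (natDegree_minpoly_tower hq (u := fun i => if i = 0 then a else b) (m := 1)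
    (r := fun _ => r) (by simpa) (by simpa) one_pos).1
  rw [image_Iic_succ, ← bot_eq_zero, Set.Iic_bot, Set.image_singleton] at this
  simpa [Set.pair_comm] using this

theorem adjoin_image_inv {ι : Type*} (f : ι → Ω) (S : Set ι) :
    adjoin L ((fun i => (f i)⁻¹) '' S) = adjoin L (f '' S) := by
  refine le_antisymm (adjoin_le_iff.2 ?_) (adjoin_le_iff.2 ?_)
  · rintro _ ⟨i, hi, rfl⟩
    exact (adjoin L (f '' S)).inv_mem (subset_adjoin _ _ ⟨i, hi, rfl⟩)
  · rintro _ ⟨i, hi, rfl⟩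
    have := (adjoin L ((fun i => (f i)⁻¹) '' S)).inv_mem (subset_adjoin _ _ ⟨i, hi, rfl⟩)
    rwa [inv_inv] at this

/-- Passing to inverses makes Z (1 + Z)^(q-1) = c⁻¹ monic in Z⁻¹ and of the shape needed to ascend
the tower. -/
theorem inv_relation (hq : 1 ≤ q) {c Z : Ω} (hZ : Z ≠ 0) (hZ1 : 1 + Z ≠ 0)
    (h : c = (Z * (1 + Z) ^ (q - 1))⁻¹) : Z⁻¹ ^ q = c * (1 + Z⁻¹) ^ (q - 1) := by
  obtain ⟨m, rfl⟩ := Nat.exists_eq_add_of_le' hq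
  have : 1 + Z⁻¹ = (1 + Z) / Z := by field_simp; ring
  rw [h, this, Nat.add_sub_cancel, div_pow, inv_pow, pow_succ]
  field_simp

end Kernel

/-! ### Degrees of ring homomorphisms. -/

section Degree

open IntermediateField

theorem hasDegree_of_relfinrank {L Ω : Type*} [Field L] [Field Ω] [Algebra L Ω]
    {M N : IntermediateField L Ω} (h : M ≤ N) {d : ℕ} (hd : 0 < d) (hMN : relfinrank M N = d)
    {A B : Type*} [CommRing A] [CommRing B] (f : A →+* B) (eA : A ≃+* M) (eB : B ≃+* N)
    (hf : ∀ a, (eB (f a) : Ω) = eA a) : HasDegree f d := by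
  rw [relfinrank_eq_finrank_of_le h] at hMN
  have : FiniteDimensional M (extendScalars h) := FiniteDimensional.of_finrank_pos (by omega)
  have : Module.Free M (extendScalars h) := Module.Free.of_divisionRing M (extendScalars h)
  let b := Module.finBasisOfFinrankEq M (extendScalars h) hMN
  let := f.toAlgebra
  let : Module A (extendScalars h) := Module.compHom (extendScalars h) eA.toRingHom
  have hs : ∀ (a : A) (x : extendScalars h), a • x = eA a • x := fun a x => rfl
  let b' := b.mapCoeffs eA.symm fun c x => by rw [hs, RingEquiv.apply_symm_apply]
  let e : B ≃+ extendScalars h := eB.toAddEquiv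
  have he : ∀ y : B, (e y : Ω) = eB y := fun y => rfl
  let e' : B ≃ₗ[A] extendScalars h := { e with
    map_smul' := fun a y => by
      apply Subtype.ext
      change (e (f a * y) : Ω) = (eA a • e y : extendScalars h)
      rw [he, map_mul]
      change (eB (f a) : Ω) * eB y = eA a * e y
      rw [hf, he] }
  exact ⟨b'.map e'.symm⟩

end Degree

/-! ### Galois theory over L(J). -/

section Generic

variable {L : Type*} [Field L] {Ω : Type*} [Field Ω] [Algebra L Ω] [Algebra (RatFunc L) Ω]
variable [IsScalarTower L (RatFunc L) Ω]

theorem transcendental_genericJ : Transcendental L (genericJ L Ω) := by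
  rw [genericJ, transcendental_algebraMap_iff (algebraMap (RatFunc L) Ω).injective]
  exact RatFunc.transcendental_X

theorem genericJ_ne_zero : genericJ L Ω ≠ 0 := by
  simp [genericJ, RatFunc.X_ne_zero]

theorem ratFunc_ringHom_ext {R : Type*} [CommRing R] {f g : RatFunc L →+* R}
    (hC : ∀ a : L, f (algebraMap L (RatFunc L) a) = g (algebraMap L (RatFunc L) a))
    (hX : f RatFunc.X = g RatFunc.X) : f = g := by
  refine IsLocalization.ringHom_ext (nonZeroDivisors L[X]) (Polynomial.ringHom_ext (fun a => ?_) ?_)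
  · simpa using hC a
  · simpa using hX

theorem algebraMap_mem_of_genericJ_mem {M : IntermediateField L Ω} (hJ : genericJ L Ω ∈ M)
    (x : RatFunc L) : algebraMap (RatFunc L) Ω x ∈ M := by
  have key : ∀ f : L[X], algebraMap (RatFunc L) Ω (algebraMap L[X] (RatFunc L) f) ∈ M := by
    intro f
    induction f using Polynomial.induction_on' with
    | add a b ha hb => rw [map_add, map_add]; exact M.add_mem ha hb
    | monomial i a =>
      rw [← C_mul_X_pow_eq_monomial, map_mul, map_mul, map_pow, map_pow, RatFunc.algebraMap_X,
        RatFunc.algebraMap_C, ← RatFunc.algebraMap_eq_C, ← IsScalarTower.algebraMap_apply]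
      exact M.mul_mem (M.algebraMap_mem a) (pow_mem hJ i)
  rw [← RatFunc.num_div_denom x, map_div₀]
  exact M.div_mem (key _) (key _)

variable (L) in
/-- An intermediate field over `L` that contains `J`, as an intermediate field over `L(J)`. -/
def overRatFunc (M : IntermediateField L Ω) (hJ : genericJ L Ω ∈ M) :
    IntermediateField (RatFunc L) Ω :=
  { M.toSubfield with algebraMap_mem' := algebraMap_mem_of_genericJ_mem hJ }

variable [IsSepClosure (RatFunc L) Ω]

/-- Embeddings of an intermediate field that fix `L` and `J` extend to automorphisms. -/
theorem exists_algEquiv_of_algHom {M : IntermediateField L Ω} (hJ : genericJ L Ω ∈ M)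
    (i : M →ₐ[L] Ω) (hi : i ⟨genericJ L Ω, hJ⟩ = genericJ L Ω) :
    ∃ σ : Ω ≃ₐ[RatFunc L] Ω, ∀ y : M, σ y = i y := by
  let E := overRatFunc L M hJ
  let i' : E →+* Ω := i.toRingHom
  have hc : i'.comp (algebraMap (RatFunc L) E) = algebraMap (RatFunc L) Ω := by
    refine ratFunc_ringHom_ext (fun a => ?_) hi
    have h1 : i (algebraMap L M a) = algebraMap L Ω a := i.commutes a
    rw [← IsScalarTower.algebraMap_apply, ← h1]
    have : algebraMap (RatFunc L) E (algebraMap L (RatFunc L) a) =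
        (⟨algebraMap L Ω a, M.algebraMap_mem a⟩ : M) :=
      Subtype.ext (IsScalarTower.algebraMap_apply L (RatFunc L) Ω a).symm
    exact congrArg i this
  let j : E →ₐ[RatFunc L] Ω := { i' with commutes' := fun x => RingHom.congr_fun hc x }
  -- A separable closure is normal over L(J), so the embedding extends; it is bijective because Ω is
  -- algebraic over L(J).
  let s : Ω →ₐ[RatFunc L] Ω := j.liftNormal Ω
  refine ⟨AlgEquiv.ofBijective s (Algebra.IsAlgebraic.algHom_bijective s), fun y => ?_⟩
  exact j.liftNormal_commutes Ω (⟨y, y.2⟩ : E)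

theorem mem_of_forall_algEquiv {M : IntermediateField L Ω} (hJ : genericJ L Ω ∈ M) {y : Ω}
    (h : ∀ σ : Ω ≃ₐ[RatFunc L] Ω, (∀ z ∈ M, σ z = z) → σ y = y) : y ∈ M := by
  have : y ∈ IntermediateField.fixedField (overRatFunc L M hJ).fixingSubgroup := by
    rw [IntermediateField.mem_fixedField_iff]
    intro σ hσ
    exact h σ fun z hz => (IntermediateField.mem_fixingSubgroup_iff _ _).1 hσ z hz
  rw [InfiniteGalois.fixedField_fixingSubgroup] at this
  exact this

end Generic

theorem infinite_of_ratFunc (L Ω : Type*) [Field L] [Field Ω] [Algebra (RatFunc L) Ω] :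
    Infinite Ω :=
  have : Infinite (RatFunc L) := Infinite.of_injective _ (RatFunc.algebraMap_injective L)
  Infinite.of_injective _ (algebraMap (RatFunc L) Ω).injective

/-! ### The function field and evaluation at a pair. -/

section FunctionField

open LevelPair

variable {k : Type*} [Field k] [Fintype k] {L : Type*} [Field L] [Algebra k L]
variable {Ω : Type*} [Field Ω] [Algebra k Ω] [Algebra L Ω] [Algebra (RatFunc L) Ω]
variable [IsScalarTower k L Ω] [IsScalarTower L (RatFunc L) Ω] [IsSepClosure (RatFunc L) Ω]
variable {n : ℕ}

local notation "q" => Fintype.card k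

/-- The rational functions `ξ_1 = x_1^(q²-1)` and `ξ_j = Z_j` for `2 ≤ j ≤ n`. -/
def IsInvariants (ξ : ℕ → functionField k L Ω n) : Prop :=
  IsX1Power (ξ 1) ∧ ∀ j, 2 ≤ j → j ≤ n → IsZ j (ξ j)

variable (k) in
/-- Automorphisms over `L(J)` are linear over `k`. -/
def toAlgEquiv (σ : Ω ≃ₐ[RatFunc L] Ω) : Ω ≃ₐ[k] Ω :=
  AlgEquiv.ofRingEquiv (f := σ.toRingEquiv) fun a => by
    rw [IsScalarTower.algebraMap_apply k L Ω, IsScalarTower.algebraMap_apply L (RatFunc L) Ω]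
    exact σ.commutes _

theorem exists_isConj_generic (σ : Ω ≃ₐ[RatFunc L] Ω) (p : GenericPair k L Ω n) :
    ∃ p' : GenericPair k L Ω n, IsConj σ.toRingEquiv p p' :=
  p.exists_isConj (toAlgEquiv k σ) (σ.commutes _)

variable (k L Ω) in
theorem exists_isInvariants (hn : 1 ≤ n) :
    ∃ ξ : ℕ → functionField k L Ω n, IsInvariants ξ := by
  have := IsSepClosure.sep_closed (k := RatFunc L) (K := Ω)
  have := infinite_of_ratFunc L Ω
  choose x hx using fun p : GenericPair k L Ω n => exists_isCoords hn p
  have hconj : ∀ (σ : Ω ≃ₐ[RatFunc L] Ω) (p p' : GenericPair k L Ω n),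
      IsConj σ.toRingEquiv p p' → IsCoords p' (fun j => σ (x p j)) := fun σ p p' h =>
    (hx p).of_isConj (toAlgEquiv k σ) (σ.commutes _) h
  let w : functionField k L Ω n := ⟨fun p => x p 1 ^ (q ^ 2 - 1),
    fun p p' h => ((hx p).of_isIso h).x_one_pow_eq hn (hx p'), fun σ p p' h => by
      rw [map_pow]
      exact (hconj σ p p' h).x_one_pow_eq hn (hx p')⟩
  let Z : ∀ j, 2 ≤ j → j ≤ n → functionField k L Ω n := fun j h2 hj =>
    ⟨fun p => (x p (j - 1) * x p j) ^ (q - 1),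
    fun p p' h => ((hx p).of_isIso h).z_pow_eq (hx p') h2 hj, fun σ p p' h => by
      rw [map_pow, map_mul]
      exact (hconj σ p p' h).z_pow_eq (hx p') h2 hj⟩
  -- Index 1 gets x_1^(q²-1); the same value at indices outside 1, …, n is a mere default.
  refine ⟨fun j => if h : 2 ≤ j ∧ j ≤ n then Z j h.1 h.2 else w, fun p y hy => ?_,
    fun j h2 hj p y hy => ?_⟩
  · beta_reduce
    rw [dif_neg (by omega)]
    exact hy.x_one_pow_eq hn (hx p)
  · beta_reduce
    rw [dif_pos ⟨h2, hj⟩]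
    exact hy.z_pow_eq (hx p) h2 hj

namespace IsInvariants

variable {ξ : ℕ → functionField k L Ω n}

theorem exists_coords (hn : 1 ≤ n) (hξ : IsInvariants ξ) (p : GenericPair k L Ω n) :
    ∃ (r : GenericPair k L Ω n) (x : ℕ → Ω), IsNormalizedCoords r x ∧ IsCoords p x ∧
      (ξ 1).1 p = x 1 ^ (q ^ 2 - 1) ∧
      ∀ j, 1 ≤ j → j + 1 ≤ n → (ξ (j + 1)).1 p = (x j * x (j + 1)) ^ (q - 1) := by
  have := IsSepClosure.sep_closed (k := RatFunc L) (K := Ω)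
  obtain ⟨x, hx⟩ := exists_isCoords hn p
  obtain ⟨r, hr, hrx⟩ := hx
  exact ⟨r, x, hrx, ⟨r, hr, hrx⟩, hξ.1 p x ⟨r, hr, hrx⟩, fun j h1 hj =>
    hξ.2 (j + 1) (by omega) hj p x ⟨r, hr, hrx⟩⟩

theorem ne_zero (hn : 1 ≤ n) (hξ : IsInvariants ξ) (p : GenericPair k L Ω n) {j : ℕ}
    (h1 : 1 ≤ j) (hj : j ≤ n) : (ξ j).1 p ≠ 0 := by
  obtain ⟨r, x, hr, -, hw, hZ⟩ := hξ.exists_coords hn p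
  rcases h1.eq_or_lt with rfl | h1
  · rw [hw]
    exact pow_ne_zero _ hr.x_one_ne_zero
  · obtain ⟨j, rfl⟩ := Nat.exists_eq_add_of_le' h1
    rw [hZ (j + 1) (by omega) hj]
    exact pow_ne_zero _ (mul_ne_zero (hr.ne_zero (by omega) (by omega))
      (hr.ne_zero (by omega) (by omega)))

theorem one_add_ne_zero (hξ : IsInvariants ξ) (p : GenericPair k L Ω n) {j : ℕ}
    (h2 : 2 ≤ j) (hj : j ≤ n) : 1 + (ξ j).1 p ≠ 0 := by
  obtain ⟨r, x, hr, -, hw, hZ⟩ := hξ.exists_coords (by omega) p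
  obtain ⟨j, rfl⟩ := Nat.exists_eq_add_of_le' h2
  obtain ⟨Z, h, -, h1, -⟩ := hr.relations (j := j + 1) (by omega) hj
  rwa [hZ (j + 1) (by omega) hj, ← h]

theorem first_relation (hn : 2 ≤ n) (hξ : IsInvariants ξ) (p : GenericPair k L Ω n) :
    (ξ 2).1 p * (1 + (ξ 2).1 p) ^ (q - 1) = (ξ 1).1 p := by
  obtain ⟨r, x, hr, -, hw, hZ⟩ := hξ.exists_coords (by omega) p
  obtain ⟨Z, h, -, -, h1, -⟩ := hr.relations (j := 1) le_rfl hn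
  rw [hZ 1 le_rfl hn, ← h, h1, hw]

theorem relation (hξ : IsInvariants ξ) (p : GenericPair k L Ω n) {j : ℕ}
    (h2 : 2 ≤ j) (hj : j + 1 ≤ n) : (ξ (j + 1)).1 p * (1 + (ξ (j + 1)).1 p) ^ (q - 1) =
      (ξ j).1 p ^ q / (1 + (ξ j).1 p) ^ (q - 1) := by
  obtain ⟨r, x, hr, -, hw, hZ⟩ := hξ.exists_coords (by omega) p
  obtain ⟨j, rfl⟩ := Nat.exists_eq_add_of_le' h2
  obtain ⟨Z, h, -, -, -, h1⟩ := hr.relations (j := j + 1) (by omega) (by omega)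
  obtain ⟨Z', h', -, -, h1', -⟩ := hr.relations (j := j + 2) (by omega) (by omega)
  rw [hZ (j + 2) (by omega) hj, ← h', h1', hZ (j + 1) (by omega) (by omega), ← h, h1]

theorem cleared_relation (hξ : IsInvariants ξ) (p : GenericPair k L Ω n) {j : ℕ}
    (h2 : 2 ≤ j) (hj : j + 1 ≤ n) : (ξ (j + 1)).1 p * (1 + (ξ (j + 1)).1 p) ^ (q - 1) *
      (1 + (ξ j).1 p) ^ (q - 1) = (ξ j).1 p ^ q := by
  rw [hξ.relation p h2 hj, div_mul_cancel₀]
  exact pow_ne_zero _ (hξ.one_add_ne_zero p h2 (by omega))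

theorem genericJ_mul (hn : 1 ≤ n) (hξ : IsInvariants ξ) (p : GenericPair k L Ω n) :
    genericJ L Ω * (ξ 1).1 p = -((ξ 1).1 p - 1) ^ (q + 1) := by
  obtain ⟨r, x, hr, -, hw, hZ⟩ := hξ.exists_coords hn p
  rw [hw, hr.J_mul_eq]

/-- The invariants separate the isomorphism classes of pairs. -/
theorem isIso (hn : 1 ≤ n) (hξ : IsInvariants ξ) {p p' : GenericPair k L Ω n}
    (h : ∀ j, 1 ≤ j → j ≤ n → (ξ j).1 p = (ξ j).1 p') : IsIso p p' := by
  obtain ⟨r, x, hr, hx, hw, hZ⟩ := hξ.exists_coords hn p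
  obtain ⟨r', x', hr', hx', hw', hZ'⟩ := hξ.exists_coords hn p'
  refine hx.isIso hx' (by rw [← hw, ← hw', h 1 le_rfl hn]) fun j h2 hj => ?_
  obtain ⟨j, rfl⟩ := Nat.exists_eq_add_of_le' h2
  have e := hZ (j + 1) (by omega) hj
  have e' := hZ' (j + 1) (by omega) hj
  rw [h (j + 1 + 1) (by omega) hj, e'] at e
  exact e

/-- Algebraicity would descend from ξ_{j+1} to ξ_j, and finally to J. -/
theorem transcendental (hn : 1 ≤ n) (hξ : IsInvariants ξ) (p : GenericPair k L Ω n) {j : ℕ}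
    (h1 : 1 ≤ j) (hj : j ≤ n) : Transcendental L ((ξ j).1 p) := by
  induction j, h1 using Nat.le_induction with
  | base =>
    intro h
    refine transcendental_genericJ (L := L) (Ω := Ω) ?_
    rw [eq_div_of_mul_eq (hξ.ne_zero hn p le_rfl hn) (hξ.genericJ_mul hn p), div_eq_mul_inv]
    exact (((h.sub isAlgebraic_one).pow _).neg).mul h.inv
  | succ j h1 ih =>
    intro h
    refine ih (by omega) ?_
    rcases h1.eq_or_lt with rfl | h1
    · rw [← hξ.first_relation hj p]
      exact h.mul ((isAlgebraic_one.add h).pow _)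
    · exact isAlgebraic_of_relation Fintype.card_pos h (hξ.cleared_relation p h1 hj).symm

/-- The point is that the right side does not depend on p. -/
theorem ker_aeval (hn : 1 ≤ n) (hξ : IsInvariants ξ) (p : GenericPair k L Ω n) :
    RingHom.ker (MvPolynomial.aeval (fun j : Set.Icc 1 n => (ξ j).1 p) :
      MvPolynomial (Set.Icc 1 n) L →ₐ[L] Ω) = Ideal.span (relations q L n) :=
  ker_aeval_eq_span_relations Fintype.card_pos hn (ξ := fun j => (ξ j).1 p)
    (hξ.transcendental hn p hn le_rfl) (fun h2 => hξ.first_relation h2 p)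
    fun _ h2 hj => hξ.cleared_relation p h2 hj

end IsInvariants

/-- The field generated by the values of the invariants at a pair. -/
def valueField (ξ : ℕ → functionField k L Ω n) (p : GenericPair k L Ω n) : IntermediateField L Ω :=
  IntermediateField.adjoin L (Set.range fun j : Set.Icc 1 n => (ξ j).1 p)

namespace IsInvariants

variable {ξ : ℕ → functionField k L Ω n}

theorem mem_valueField {ξ : ℕ → functionField k L Ω n} (p : GenericPair k L Ω n) {j : ℕ}
    (h1 : 1 ≤ j) (hj : j ≤ n) : (ξ j).1 p ∈ valueField ξ p :=
  IntermediateField.subset_adjoin _ _ ⟨⟨j, h1, hj⟩, rfl⟩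

theorem genericJ_mem (hn : 1 ≤ n) (hξ : IsInvariants ξ) (p : GenericPair k L Ω n) :
    genericJ L Ω ∈ valueField ξ p := by
  have h1 := mem_valueField (ξ := ξ) p le_rfl hn
  rw [eq_div_of_mul_eq (hξ.ne_zero hn p le_rfl hn) (hξ.genericJ_mul hn p)]
  exact div_mem (neg_mem (pow_mem (sub_mem h1 (one_mem _)) _)) h1

/-- Both value fields are images of the fraction field of the same domain, the polynomial ring
modulo the relations. -/
theorem exists_algHom (hn : 1 ≤ n) (hξ : IsInvariants ξ) (p p' : GenericPair k L Ω n) :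
    ∃ i : valueField ξ p →ₐ[L] Ω, ∀ j (h1 : 1 ≤ j) (hj : j ≤ n),
      i ⟨(ξ j).1 p, mem_valueField p h1 hj⟩ = (ξ j).1 p' := by
  let I := Ideal.span (relations q L n)
  let e : ∀ p : GenericPair k L Ω n, MvPolynomial (Set.Icc 1 n) L →ₐ[L] Ω := fun p =>
    MvPolynomial.aeval (fun j : Set.Icc 1 n => (ξ j).1 p)
  have hker : ∀ p, RingHom.ker (e p) = I := hξ.ker_aeval hn
  have : I.IsPrime := hker p ▸ RingHom.ker_isPrime (e p)
  let A := MvPolynomial (Set.Icc 1 n) L ⧸ I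
  let l : ∀ p : GenericPair k L Ω n, A →ₐ[L] Ω := fun p =>
    Ideal.Quotient.liftₐ I (e p) fun a ha => by rwa [← hker p] at ha
  have hl : ∀ p, Function.Injective (l p) := by
    intro p
    rw [injective_iff_map_eq_zero]
    intro a ha
    obtain ⟨a, rfl⟩ := Ideal.Quotient.mk_surjective a
    rw [Ideal.Quotient.eq_zero_iff_mem, ← hker p]
    exact ha
  let θ : ∀ p : GenericPair k L Ω n, FractionRing A →ₐ[L] Ω := fun p =>
    IsFractionRing.liftAlgHom (hl p)
  let y : Set.Icc 1 n → FractionRing A := fun j =>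
    algebraMap A (FractionRing A) (Ideal.Quotient.mk I (MvPolynomial.X j))
  have hy : ∀ p j, θ p (y j) = (ξ j).1 p := by
    intro p j
    have h1 : θ p (y j) = l p (Ideal.Quotient.mk I (MvPolynomial.X j)) :=
      IsFractionRing.lift_algebraMap (hl p) _
    have h2 : l p (Ideal.Quotient.mk I (MvPolynomial.X j)) = e p (MvPolynomial.X j) := rfl
    rw [h1, h2, MvPolynomial.aeval_X]
  have hle : valueField ξ p ≤ (θ p).fieldRange := by
    refine IntermediateField.adjoin_le_iff.2 ?_
    rintro _ ⟨j, rfl⟩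
    exact ⟨y j, hy p j⟩
  refine ⟨((θ p').comp (AlgEquiv.ofInjectiveField (θ p)).symm.toAlgHom).comp
    (IntermediateField.inclusion hle), fun j h1 hj => ?_⟩
  rw [← hy p' ⟨j, h1, hj⟩]
  refine congrArg (θ p') ?_
  change (AlgEquiv.ofInjectiveField (θ p)).symm _ = _
  rw [AlgEquiv.symm_apply_eq]
  exact Subtype.ext (hy p ⟨j, h1, hj⟩).symm

/-- The Galois group acts transitively on the isomorphism classes of pairs. -/
theorem exists_isConj_isIso (hn : 1 ≤ n) (hξ : IsInvariants ξ) (p p' : GenericPair k L Ω n) :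
    ∃ (σ : Ω ≃ₐ[RatFunc L] Ω) (r : GenericPair k L Ω n),
      IsConj σ.toRingEquiv p r ∧ IsIso r p' := by
  obtain ⟨i, hi⟩ := hξ.exists_algHom hn p p'
  have hJ := hξ.genericJ_mem hn p
  obtain ⟨σ, hσ⟩ := exists_algEquiv_of_algHom hJ i (by
    -- The embedding fixes J, because J is the same rational function of ξ_1 at p and at p'.
    have h := congrArg i (Subtype.ext (hξ.genericJ_mul hn p) :
      (⟨_, hJ⟩ * ⟨_, mem_valueField p le_rfl hn⟩ : valueField ξ p) =
        -(⟨_, mem_valueField p le_rfl hn⟩ - 1) ^ (q + 1))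
    rw [map_mul, map_neg, map_pow, map_sub, map_one, hi 1 le_rfl hn,
      ← hξ.genericJ_mul hn p'] at h
    exact mul_right_cancel₀ (hξ.ne_zero hn p' le_rfl hn) h)
  obtain ⟨r, hr⟩ := exists_isConj_generic σ p
  refine ⟨σ, r, hr, hξ.isIso hn fun j h1 hj => ?_⟩
  rw [(ξ j).2.2 σ p r hr, ← hi j h1 hj]
  exact hσ ⟨_, mem_valueField p h1 hj⟩

theorem eq_of_apply_eq (hn : 1 ≤ n) (hξ : IsInvariants ξ) (p : GenericPair k L Ω n)
    {f g : functionField k L Ω n} (h : f.1 p = g.1 p) : f = g := by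
  refine Subtype.ext (funext fun p' => ?_)
  obtain ⟨σ, r, hr, hr'⟩ := hξ.exists_isConj_isIso hn p p'
  rw [f.2.1 r p' hr', g.2.1 r p' hr', f.2.2 σ p r hr, g.2.2 σ p r hr, h]

/-- An automorphism fixing the invariants of p carries p to an isomorphic pair, hence fixes f(p);
Galois theory does the rest. -/
theorem apply_mem_valueField (hn : 1 ≤ n) (hξ : IsInvariants ξ) (p : GenericPair k L Ω n)
    (f : functionField k L Ω n) : f.1 p ∈ valueField ξ p := by
  refine mem_of_forall_algEquiv (hξ.genericJ_mem hn p) fun σ hσ => ?_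
  obtain ⟨r, hr⟩ := exists_isConj_generic σ p
  rw [← f.2.2 σ p r hr]
  refine (f.2.1 p r (hξ.isIso hn fun j h1 hj => ?_))
  rw [(ξ j).2.2 σ p r hr, hσ _ (mem_valueField p h1 hj)]

end IsInvariants

/-- The pointwise inverse of a rational function. -/
def functionInv (f : functionField k L Ω n) : functionField k L Ω n :=
  ⟨fun p => (f.1 p)⁻¹, fun p p' h => congrArg (·⁻¹) (f.2.1 p p' h),
    fun σ p p' h => (congrArg (·⁻¹) (f.2.2 σ p p' h)).trans (map_inv₀ σ _).symm⟩

variable (k L Ω) in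
/-- Evaluation of rational functions at a pair. -/
def evalAt (p : GenericPair k L Ω n) : functionField k L Ω n →ₐ[L] Ω :=
  (Pi.evalAlgHom L (fun _ => Ω) p).comp (functionField k L Ω n).val

theorem evalAt_apply (p : GenericPair k L Ω n) (f : functionField k L Ω n) :
    evalAt k L Ω p f = f.1 p := rfl

namespace IsInvariants

variable {ξ : ℕ → functionField k L Ω n}

/-- The values at p form a field, since pointwise inverses of rational functions are rational
functions. -/
theorem exists_apply_eq (p : GenericPair k L Ω n) {y : Ω} (hy : y ∈ valueField ξ p) :
    ∃ f : functionField k L Ω n, f.1 p = y := by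
  let M : IntermediateField L Ω := { (evalAt k L Ω p).range with
    inv_mem' := by
      rintro _ ⟨f, rfl⟩
      exact ⟨functionInv f, rfl⟩ }
  have hle : valueField ξ p ≤ M := by
    refine IntermediateField.adjoin_le_iff.2 ?_
    rintro _ ⟨j, rfl⟩
    exact ⟨ξ j, rfl⟩
  exact hle hy

/-- The function field is isomorphic to the field generated by the values at a pair. -/
def evalEquiv (hn : 1 ≤ n) (hξ : IsInvariants ξ) (p : GenericPair k L Ω n) :
    functionField k L Ω n ≃+* valueField ξ p :=
  RingEquiv.ofBijective
    ((evalAt k L Ω p).toRingHom.codRestrict (valueField ξ p).toSubfield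
      (hξ.apply_mem_valueField hn p))
    ⟨fun _ _ h => hξ.eq_of_apply_eq hn p (congrArg Subtype.val h), fun y =>
      (exists_apply_eq p y.2).imp fun _ h => Subtype.ext h⟩

theorem evalEquiv_apply (hn : 1 ≤ n) (hξ : IsInvariants ξ) (p : GenericPair k L Ω n)
    (f : functionField k L Ω n) : (hξ.evalEquiv hn p f : Ω) = f.1 p := rfl

theorem isField (hn : 1 ≤ n) (hξ : IsInvariants ξ) (p : GenericPair k L Ω n) :
    IsField (functionField k L Ω n) :=
  (hξ.evalEquiv hn p).toMulEquiv.isField (Field.toIsField (valueField ξ p))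

theorem ker_aeval_functionField (hn : 1 ≤ n) (hξ : IsInvariants ξ) (p : GenericPair k L Ω n) :
    RingHom.ker (MvPolynomial.aeval (fun j : Set.Icc 1 n => ξ j) :
      MvPolynomial (Set.Icc 1 n) L →ₐ[L] functionField k L Ω n) =
        Ideal.span (relations q L n) := by
  rw [← hξ.ker_aeval hn p]
  ext f
  have h : evalAt k L Ω p (MvPolynomial.aeval (fun j : Set.Icc 1 n => ξ j) f) =
      MvPolynomial.aeval (fun j : Set.Icc 1 n => (ξ j).1 p) f := by
    rw [MvPolynomial.comp_aeval_apply]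
    rfl
  rw [RingHom.mem_ker, RingHom.mem_ker, ← h]
  exact ⟨fun h0 => by rw [h0, map_zero], fun h0 => hξ.eq_of_apply_eq hn p h0⟩

theorem exists_generators (hn : 2 ≤ n) (hξ : IsInvariants ξ) (p : GenericPair k L Ω n)
    (f : functionField k L Ω n) : ∃ A B : MvPolynomial (Set.Icc 2 n) L,
      MvPolynomial.aeval (fun j : Set.Icc 2 n => ξ j) B ≠ 0 ∧
      f * MvPolynomial.aeval (fun j : Set.Icc 2 n => ξ j) B =
        MvPolynomial.aeval (fun j : Set.Icc 2 n => ξ j) A := by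
  have hn1 : 1 ≤ n := by omega
  have hle : valueField ξ p ≤
      IntermediateField.adjoin L (Set.range fun j : Set.Icc 2 n => (ξ j).1 p) := by
    have h2 : ∀ j : ℕ, 2 ≤ j → j ≤ n → (ξ j).1 p ∈
        IntermediateField.adjoin L (Set.range fun j : Set.Icc 2 n => (ξ j).1 p) :=
      fun j h2 hj => IntermediateField.subset_adjoin _ _ ⟨⟨j, h2, hj⟩, rfl⟩
    refine IntermediateField.adjoin_le_iff.2 ?_
    rintro _ ⟨⟨j, h1, hj⟩, rfl⟩
    change (ξ j).1 p ∈ _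
    rcases h1.eq_or_lt with rfl | h1
    · have := h2 2 le_rfl hn
      rw [← hξ.first_relation hn p]
      exact mul_mem this (pow_mem (add_mem (one_mem _) this) _)
    · exact h2 j h1 hj
  have hev : ∀ g : MvPolynomial (Set.Icc 2 n) L,
      (MvPolynomial.aeval (fun j : Set.Icc 2 n => ξ j) g).1 p =
        MvPolynomial.aeval (fun j : Set.Icc 2 n => (ξ j).1 p) g := by
    intro g
    rw [← evalAt_apply, MvPolynomial.comp_aeval_apply]
    rfl
  obtain ⟨A, B, hAB⟩ := (IntermediateField.mem_adjoin_range_iff _ _ _).1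
    (hle (hξ.apply_mem_valueField hn1 p f))
  -- Membership gives only f(p) = A / B with B possibly zero; then f(p) = 0 by the convention for
  -- division, and 0 / 1 serves instead.
  by_cases hB : MvPolynomial.aeval (fun j : Set.Icc 2 n => (ξ j).1 p) B = 0
  · refine ⟨0, 1, ?_, ?_⟩
    · rw [map_one]
      have := (hξ.isField hn1 p).nontrivial
      exact one_ne_zero
    · rw [map_one, mul_one, map_zero]
      refine hξ.eq_of_apply_eq hn1 p ?_
      rw [hAB, hB, div_zero]
      rfl
  · refine ⟨A, B, fun h => hB ?_, hξ.eq_of_apply_eq hn1 p ?_⟩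
    · rw [← hev, h]
      rfl
    · change f.1 p * (MvPolynomial.aeval (fun j : Set.Icc 2 n => ξ j) B).1 p = _
      rw [hev, hev, hAB, div_mul_cancel₀ _ hB]

end IsInvariants

end FunctionField

/-! ### Degrees in the tower of modular curves. -/

section Covers

open LevelPair IntermediateField

variable {k : Type*} [Field k] [Fintype k] {L : Type*} [Field L] [Algebra k L]
variable {Ω : Type*} [Field Ω] [Algebra k Ω] [Algebra L Ω] [Algebra (RatFunc L) Ω]
variable [IsScalarTower k L Ω] [IsScalarTower L (RatFunc L) Ω] [IsSepClosure (RatFunc L) Ω]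
variable {n : ℕ}

local notation "q" => Fintype.card k

theorem pullback_apply {m : ℕ} (h : m ≤ n) (f : functionField k L Ω m) (p : GenericPair k L Ω n) :
    (pullback h f).1 p = f.1 (p.degeneracy h) := rfl

namespace IsInvariants

variable {ξ : ℕ → functionField k L Ω n}

theorem valueField_eq (ξ : ℕ → functionField k L Ω n) (hn : 1 ≤ n) (p : GenericPair k L Ω n) :
    valueField ξ p = adjoin L ((fun i => (ξ (i + 1)).1 p) '' Set.Iic (n - 1)) := by
  rw [valueField]
  congr 1
  ext y
  constructor
  · rintro ⟨⟨j, h1, hj⟩, rfl⟩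
    refine ⟨j - 1, by simp only [Set.mem_Iic]; omega, ?_⟩
    simp only [Nat.sub_add_cancel h1]
  · rintro ⟨i, hi, rfl⟩
    rw [Set.mem_Iic] at hi
    exact ⟨⟨i + 1, by omega, by omega⟩, rfl⟩

theorem pullback_eq {m : ℕ} (hm : 1 ≤ m) (h : m ≤ n) (hξ : IsInvariants ξ)
    {ξ' : ℕ → functionField k L Ω m} (hξ' : IsInvariants ξ') {j : ℕ} (h1 : 1 ≤ j) (hj : j ≤ m) :
    pullback h (ξ' j) = ξ j := by
  refine Subtype.ext (funext fun p => ?_)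
  rw [pullback_apply]
  have := IsSepClosure.sep_closed (k := RatFunc L) (K := Ω)
  obtain ⟨x, hx⟩ := exists_isCoords (hm.trans h) p
  have hx' := hx.degeneracy hm h
  rcases h1.eq_or_lt with rfl | h1
  · rw [hξ'.1 _ x hx', hξ.1 p x hx]
  · rw [hξ'.2 j h1 hj _ x hx', hξ.2 j h1 (hj.trans h) p x hx]

theorem inv_tower_relation (hξ : IsInvariants ξ) (p : GenericPair k L Ω n) {j : ℕ} (h2 : 2 ≤ j)
    (hj : j + 1 ≤ n) : ((ξ (j + 1)).1 p)⁻¹ ^ q =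
      ((ξ j).1 p)⁻¹ * (1 + ((ξ j).1 p)⁻¹) ^ (q - 1) * (1 + ((ξ (j + 1)).1 p)⁻¹) ^ (q - 1) := by
  have h0 := hξ.ne_zero (by omega) p (j := j) (by omega) (by omega)
  have h1 := hξ.one_add_ne_zero p h2 (by omega)
  refine inv_relation Fintype.card_pos (hξ.ne_zero (by omega) p (by omega) hj)
    (hξ.one_add_ne_zero p (by omega) hj) ?_
  have : 1 + ((ξ j).1 p)⁻¹ = (1 + (ξ j).1 p) / (ξ j).1 p := by field_simp; ring
  rw [hξ.relation p h2 hj, this, div_pow, pow_card_eq_mul k]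
  field_simp

/-- The ascending tower of inverses starts at 1 / x_1^(q²-1). Its first relation lacks the factor (1
+ t)^(q-1), hence the exponent 0 there. -/
theorem relfinrank_valueField (hn : 2 ≤ n) (hξ : IsInvariants ξ) (p : GenericPair k L Ω n) :
    relfinrank (adjoin L ((fun i => (ξ (i + 1)).1 p) '' Set.Iic (n - 2)))
      (adjoin L ((fun i => (ξ (i + 1)).1 p) '' Set.Iic (n - 1))) = q := by
  have := (natDegree_minpoly_tower (L := L) (Fintype.card_pos : 0 < q) (m := n - 1)
    (u := fun i => ((ξ (i + 1)).1 p)⁻¹) (r := fun i => if i = 0 then 0 else q - 1) ?_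
    (fun i hi => ?_) (i := n - 2) (by omega)).1
  · rwa [adjoin_image_inv, adjoin_image_inv, show n - 2 + 1 = n - 1 by omega] at this
  · intro h
    exact hξ.transcendental (by omega) p le_rfl (by omega) (by simpa using h.inv)
  · rcases i.eq_zero_or_pos with rfl | hi0
    · refine inv_relation Fintype.card_pos (hξ.ne_zero (by omega) p (by omega) (by omega))
        (hξ.one_add_ne_zero p (by omega) (by omega)) ?_
      simp [hξ.first_relation hn p]
    · simp only [if_neg hi0.ne']
      exact hξ.inv_tower_relation p (by omega) (by omega)

theorem hasDegree_pullback (hn : 2 ≤ n) (hξ : IsInvariants ξ) (p : GenericPair k L Ω n) :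
    HasDegree (pullback (k := k) (L := L) (Ω := Ω) (Nat.sub_le n 1)).toRingHom q := by
  have hn1 : 1 ≤ n - 1 := by omega
  obtain ⟨ξ', hξ'⟩ := exists_isInvariants k L Ω hn1
  have hval : valueField ξ' (p.degeneracy (Nat.sub_le n 1)) =
      adjoin L ((fun i => (ξ (i + 1)).1 p) '' Set.Iic (n - 2)) := by
    rw [valueField_eq ξ' hn1]
    congr 1
    refine Set.image_congr fun i hi => ?_
    rw [Set.mem_Iic] at hi
    rw [← hξ.pullback_eq hn1 (Nat.sub_le n 1) hξ' (j := i + 1) (by omega) (by omega),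
      pullback_apply]
  have hval' := valueField_eq ξ (by omega) p
  refine hasDegree_of_relfinrank (M := valueField ξ' (p.degeneracy (Nat.sub_le n 1)))
    (N := valueField ξ p) ?_ Fintype.card_pos ?_ _ (hξ'.evalEquiv hn1 _)
    (hξ.evalEquiv (by omega) p) fun f => ?_
  · rw [hval, hval']
    exact adjoin.mono _ _ _ (Set.image_mono (Set.Iic_subset_Iic.2 (by omega)))
  · rw [hval, hval', hξ.relfinrank_valueField hn p]
  · rw [evalEquiv_apply, evalEquiv_apply, AlgHom.toRingHom_eq_coe, RingHom.coe_coe,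
      pullback_apply]

/-- Over L(Z_j) the one-step tower is that of the inverses, ramified above the pole of Z_j; over
L(Z_{j+1}) it is the cleared relation, ramified above the zero of Z_{j+1}. -/
theorem relfinrank_adjacent (hξ : IsInvariants ξ) (p : GenericPair k L Ω n) {j : ℕ} (h2 : 2 ≤ j)
    (hj : j + 1 ≤ n) :
    relfinrank L⟮(ξ j).1 p⟯ L⟮(ξ j).1 p, (ξ (j + 1)).1 p⟯ = q ∧
      relfinrank L⟮(ξ (j + 1)).1 p⟯ L⟮(ξ j).1 p, (ξ (j + 1)).1 p⟯ = q := by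
  constructor
  · have := relfinrank_adjoin_pair (L := L) Fintype.card_pos (fun h =>
      hξ.transcendental (by omega) p (j := j) (by omega) (by omega) (by simpa using h.inv))
      (hξ.inv_tower_relation p h2 hj)
    have e := adjoin_image_inv (L := L) (fun x : Ω => x) {(ξ j).1 p}
    have e' := adjoin_image_inv (L := L) (fun x : Ω => x) {(ξ j).1 p, (ξ (j + 1)).1 p}
    rw [Set.image_singleton, Set.image_singleton] at e
    rw [Set.image_pair, Set.image_pair] at e'
    rwa [e, e'] at this
  · have := relfinrank_adjoin_pair (L := L) Fintype.card_pos
      (hξ.transcendental (by omega) p (by omega) hj) (hξ.cleared_relation p h2 hj).symm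
    rwa [Set.pair_comm] at this

end IsInvariants

end Covers

end DrinfeldTower

end

open DrinfeldTower IntermediateField in
theorem mainTheorem2 (k : Type*) [Field k] [Fintype k] (L : Type*) [Field L] [Algebra k L]
    (Ω : Type*) [Field Ω] [Algebra k Ω] [Algebra L Ω] [Algebra (RatFunc L) Ω]
    [IsScalarTower k L Ω] [IsScalarTower L (RatFunc L) Ω] [IsSepClosure (RatFunc L) Ω]
    (n : ℕ) (hn : 2 ≤ n) :
    -- the curve is irreducible
    IsField (functionField k L Ω n) ∧
    -- every pair has coordinates, and these define rational functions `x_1^(q^2-1)` and `Z_j`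
    (∀ p : GenericPair k L Ω n, ∃ x, IsCoords p x) ∧
    ∃ (w : functionField k L Ω n) (Z : ℕ → functionField k L Ω n),
      IsX1Power w ∧ (∀ j, 2 ≤ j → j ≤ n → IsZ j (Z j)) ∧
      -- the function field is generated over `L` by `Z_2, …, Z_n`
      (∀ f : functionField k L Ω n, ∃ A B : MvPolynomial (Set.Icc 2 n) L,
        MvPolynomial.aeval (fun j : Set.Icc 2 n => Z j) B ≠ 0 ∧
        f * MvPolynomial.aeval (fun j : Set.Icc 2 n => Z j) B =
          MvPolynomial.aeval (fun j : Set.Icc 2 n => Z j) A) ∧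
      -- the relations
      (∀ p, (Z 2).1 p * (1 + (Z 2).1 p) ^ (Fintype.card k - 1) = w.1 p) ∧
      (∀ j, 2 ≤ j → j ≤ n → ∀ p, 1 + (Z j).1 p ≠ 0) ∧
      (∀ j, 2 ≤ j → j ≤ n - 1 → ∀ p,
        (Z (j + 1)).1 p * (1 + (Z (j + 1)).1 p) ^ (Fintype.card k - 1) =
          (Z j).1 p ^ Fintype.card k / (1 + (Z j).1 p) ^ (Fintype.card k - 1)) ∧
      -- there are no others
      RingHom.ker (MvPolynomial.aeval
          (fun j : Set.Icc 1 n => if (j : ℕ) = 1 then w else Z j) :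
            MvPolynomial (Set.Icc 1 n) L →ₐ[L] functionField k L Ω n) =
        Ideal.span (relations (Fintype.card k) L n) ∧
      -- `Z_{j+1}` is algebraic of degree `q` over `L(Z_j)`, and vice versa
      (∀ j, 2 ≤ j → j ≤ n - 1 → ∀ p,
        relfinrank L⟮(Z j).1 p⟯ L⟮(Z j).1 p, (Z (j + 1)).1 p⟯ = Fintype.card k ∧
        relfinrank L⟮(Z (j + 1)).1 p⟯ L⟮(Z j).1 p, (Z (j + 1)).1 p⟯ = Fintype.card k) ∧
      -- the natural map from level `T^n` to level `T^(n-1)` is a cover of degree `q`,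
      -- compatible with the coordinates
      HasDegree (pullback (k := k) (L := L) (Ω := Ω) (Nat.sub_le n 1)).toRingHom
        (Fintype.card k) ∧
      (∃ w' : functionField k L Ω (n - 1), IsX1Power w' ∧ pullback (Nat.sub_le n 1) w' = w) ∧
      (∀ j, 2 ≤ j → j ≤ n - 1 → ∃ f : functionField k L Ω (n - 1),
        IsZ j f ∧ pullback (Nat.sub_le n 1) f = Z j) := by
  have hn1 : 1 ≤ n := by omega
  have := IsSepClosure.sep_closed (k := RatFunc L) (K := Ω)
  obtain ⟨p₀⟩ : Nonempty (GenericPair k L Ω n) := exists_levelPair hn1 genericJ_ne_zero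
  obtain ⟨ξ, hξ⟩ := exists_isInvariants k L Ω hn1
  have hn1' : 1 ≤ n - 1 := by omega
  obtain ⟨ξ', hξ'⟩ := exists_isInvariants k L Ω hn1'
  refine ⟨hξ.isField hn1 p₀, exists_isCoords hn1, ξ 1, ξ, hξ.1, hξ.2,
    hξ.exists_generators hn p₀, hξ.first_relation hn, fun j h2 hj p => hξ.one_add_ne_zero p h2 hj,
    fun j h2 hj p => hξ.relation p h2 (by omega), ?_,
    fun j h2 hj p => hξ.relfinrank_adjacent p h2 (by omega), hξ.hasDegree_pullback hn p₀,
    ⟨ξ' 1, hξ'.1, hξ.pullback_eq hn1' _ hξ' le_rfl hn1'⟩,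
    fun j h2 hj => ⟨ξ' j, hξ'.2 j h2 hj, hξ.pullback_eq hn1' _ hξ' (by omega) hj⟩⟩
  rw [← hξ.ker_aeval_functionField hn1 p₀]
  congr 3
  funext j
  split_ifs with h
  · rw [h]
  · rfl
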